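/- Let $r\ge 3$ be an integer, $q=e^{2\pi i/r}$, and for $k\in\mathbb Z$ let $[k]=\frac{q^{k/2}-q^{-k/2}}{q^{1/2}-q^{-1/2}}$ with $q^{1/2}=e^{\pi i/r}$; put $\beta=[2]^2$. A $(2,r)$-diagram is a Young diagram $\lambda=[\lambda_1,\lambda_2]$ with at most two rows and $\lambda_1-\lambda_2\le r-2$. For such a $\lambda$ with $n$ boxes let $T_\lambda$ be the set of standard tableaux $t$ of shape $\lambda$ such that, when $n,n-1,\dots,1$ are deleted from $t$ one at a time, every tableau that appears has a $(2,r)$-diagram as its shape, and let $V_\lambda$ be the complex Hilbert space with orthonormal basis $\{v_t: t\in T_\lambda\}$. If $i$ is in row $r_1$ and column $c_1$ of $t$, and $i+1$ in row $r_2$ and column $c_2$, put $d=c_1-c_2-(r_1-r_2)$, $\alpha_{t,i}=\frac{[d+1]}{[2][d]}$, $\beta_{t,i}=\sqrt{\alpha_{t,i}(1-\alpha_{t,i})}$, and for $1\le i\le n-1$ define $$e_i v_t=\alpha_{t,i}v_t+\beta_{t,i}v_{g_i(t)},$$ where $g_i(t)$ is $t$ with $i$ and $i+1$ exchanged, and the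 second term is omitted if $g_i(t)\notin T_\lambda$. Let $B_n$ be the braid group with its standard generators $\sigma_1,\dots,\sigma_{n-1}$. The sector $\rho_{\lambda,\beta,n}:B_n\to \mathbf U(V_\lambda)$ of the Jones representation is the unitary representation with $\rho_{\lambda,\beta,n}(\sigma_i)=q-(1+q)e_i$. Then: (i) For every $r\ge3$ and every $(2,r)$-diagram $\lambda$ with $n$ boxes, $\rho_{\lambda,\beta,n}$ is irreducible. (ii) If $r\ne 3,4,6,10$, $n\ge 3$ and $\lambda_2\ge 1$, then the subgroup $H$ of $\mathbf U(V_\lambda)$ generated by $\rho_{\lambda,\beta,n}(\sigma_1)$ and $\rho_{\lambda,\beta,n}(\sigma_2)$ is infinite modulo centre: its image in $\mathbf U(V_\lambda)/Z(\mathbf U(V_\lambda))$ is infinite, and so is $H/Z(H)$. (For $\lambda=[2,1]$, $n=3$, the group $\mathbf U(V_\lambda)$ is $\mathbf U(2)$.) (iii) The numbers $-1$ and $q$ are distinct, and every eigenvalue of $\rho_{\lambda,\beta,n}(\sigma_i)$, $1\le i\le n-1$, is $-1$ or $q$. If $r\ge4$, $n\ge3$ and $\lambda_2\ge1$, then both occur,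 so that $\rho_{\lambda,\beta,n}(\sigma_i)$ has exactly the two distinct eigenvalues $-1$ and $q$. (iv) For $r=5$, $\lambda=[4,2]$, $n=6$, the eigenvalues $-1$ and $q$ of every $\rho_{\lambda,\beta,6}(\sigma_i)$, $1\le i\le 5$, have multiplicities $3$ and $5$, respectively. -/

import Mathlib

namespace JonesSector

/-! ### The braid group -/

/-- The relators of the `n`-strand braid group.  The index `i : Fin (n - 1)` stands for the
generator usually written `σ_{i+1}`. -/
def braidRels (n : ℕ) : Set (FreeGroup (Fin (n - 1))) :=
  {w | ∃ i j : Fin (n - 1), (i.val + 1 < j.val ∨ j.val + 1 < i.val) ∧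
      w = FreeGroup.of i * FreeGroup.of j * (FreeGroup.of i)⁻¹ * (FreeGroup.of j)⁻¹} ∪
  {w | ∃ i j : Fin (n - 1), (i.val + 1 = j.val ∨ j.val + 1 = i.val) ∧
      w = FreeGroup.of i * FreeGroup.of j * FreeGroup.of i *
        (FreeGroup.of j * FreeGroup.of i * FreeGroup.of j)⁻¹}

/-- The `n`-strand braid group, by its Artin presentation. -/
abbrev BraidGroup (n : ℕ) : Type := PresentedGroup (braidRels n)

/-- The standard generators; `σ i` is `σ_{i+1}` in one-based numbering. -/
def BraidGroup.σ {n : ℕ} (i : Fin (n - 1)) : BraidGroup n := PresentedGroup.of i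

/-! ### Diagrams and tableaux -/

/-- `(2,r)`-diagrams: at most two rows, and `λ₁ - λ₂ ≤ r - 2`. -/
def IsTwoRow (r : ℕ) (μ : YoungDiagram) : Prop :=
  μ.colLen 0 ≤ 2 ∧ (μ.rowLen 0 : ℤ) - μ.rowLen 1 ≤ (r : ℤ) - 2

/-- Standard tableaux of shape `μ` with `n` boxes such that, when the largest entries are deleted
one at a time, every tableau that appears has a `(2,r)`-diagram as its shape.  The tableau is
recorded by the cell `(row, column)` in which each entry sits; the entry usually written `j + 1`
is `j : Fin n`, and rows and columns are counted from `0`. -/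
@[ext]
structure Tableau (r n : ℕ) (μ : YoungDiagram) where
  cell : Fin n ≃ μ.cells
  standard : ∀ j k : Fin n, (cell j : ℕ × ℕ) ≤ cell k → j ≤ k
  truncation : ∀ m ≤ n, ∃ ν : YoungDiagram, IsTwoRow r ν ∧
    ∀ c : ℕ × ℕ, c ∈ ν ↔ ∃ j : Fin n, j.val < m ∧ (cell j : ℕ × ℕ) = c

noncomputable instance (r n : ℕ) (μ : YoungDiagram) : DecidableEq (Tableau r n μ) :=
  Classical.decEq _

noncomputable instance (r n : ℕ) (μ : YoungDiagram) : Fintype (Tableau r n μ) :=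
  Fintype.ofInjective Tableau.cell fun _ _ h => Tableau.ext h

/-- The smaller of the two entries exchanged by the `i`-th transposition. -/
def lo {n : ℕ} (i : Fin (n - 1)) : Fin n := ⟨i.val, by omega⟩

/-- The larger of the two entries exchanged by the `i`-th transposition. -/
def hi {n : ℕ} (i : Fin (n - 1)) : Fin n := ⟨i.val + 1, by omega⟩

/-! ### The matrices -/

/-- `q = e^{2πi/r}`. -/
noncomputable def q (r : ℕ) : ℂ := Complex.exp (2 * Real.pi * Complex.I / r)

/-- The quantum integer `[k] = (q^{k/2} - q^{-k/2}) / (q^{1/2} - q^{-1/2})` with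
`q^{1/2} = e^{πi/r}`, as a real number; see `qInt_eq`. -/
noncomputable def qInt (r : ℕ) (k : ℤ) : ℝ :=
  Real.sin (k * (Real.pi / r)) / Real.sin (Real.pi / r)

theorem qInt_eq (r : ℕ) (k : ℤ) :
    (qInt r k : ℂ) =
      (Complex.exp (Real.pi * Complex.I / r) ^ k - Complex.exp (Real.pi * Complex.I / r) ^ (-k)) /
      (Complex.exp (Real.pi * Complex.I / r) - (Complex.exp (Real.pi * Complex.I / r))⁻¹) := by
  have h : ∀ x : ℂ, Complex.exp (x * Complex.I) - Complex.exp (-(x * Complex.I)) =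
      Complex.sin x * (2 * Complex.I) := by
    intro x
    rw [Complex.sin, neg_mul]
    linear_combination (-(Complex.exp (-(x * Complex.I)) - Complex.exp (x * Complex.I))) *
      Complex.I_sq
  have e1 : (Real.pi * Complex.I / r : ℂ) = (Real.pi / r : ℂ) * Complex.I := by ring
  rw [← Complex.exp_int_mul, ← Complex.exp_int_mul, ← Complex.exp_neg, e1, h]
  have e2 : ((k : ℂ) * ((Real.pi / r : ℂ) * Complex.I)) = (k * (Real.pi / r)) * Complex.I := by
    ring
  have e3 : (((-k : ℤ) : ℂ) * ((Real.pi / r : ℂ) * Complex.I)) =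
      -((k * (Real.pi / r)) * Complex.I) := by push_cast; ring
  rw [e2, e3, h, mul_div_mul_right _ _ (by simp), qInt]
  push_cast
  rfl

namespace Tableau

variable {r n : ℕ} {μ : YoungDiagram}

/-- `d_{t,i} = c₁ - c₂ - (r₁ - r₂)`, where the entries `i`, `i+1` sit in row `r₁`, `r₂` and
column `c₁`, `c₂`. -/
def d (t : Tableau r n μ) (i : Fin (n - 1)) : ℤ :=
  ((t.cell (lo i) : ℕ × ℕ).2 : ℤ) - ((t.cell (hi i) : ℕ × ℕ).2 : ℤ) -
    (((t.cell (lo i) : ℕ × ℕ).1 : ℤ) - ((t.cell (hi i) : ℕ × ℕ).1 : ℤ))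

/-- `α_{t,i} = [d_{t,i} + 1] / ([2] [d_{t,i}])`. -/
noncomputable def alpha (t : Tableau r n μ) (i : Fin (n - 1)) : ℝ :=
  qInt r (t.d i + 1) / (qInt r 2 * qInt r (t.d i))

/-- `β_{t,i} = √(α_{t,i} (1 - α_{t,i}))`. -/
noncomputable def beta (t : Tableau r n μ) (i : Fin (n - 1)) : ℝ :=
  Real.sqrt (t.alpha i * (1 - t.alpha i))

/-- The filling obtained from `t` by exchanging the entries `i` and `i+1`. -/
def swapped (t : Tableau r n μ) (i : Fin (n - 1)) : Fin n ≃ μ.cells :=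
  (Equiv.swap (lo i) (hi i)).trans t.cell

end Tableau

/-- The matrix of the `i`-th Temperley-Lieb-Jones projector in the basis `v_t`:
`e_i v_t = α_{t,i} v_t + β_{t,i} v_{g_i(t)}`, where the second term is absent if the filling
`g_i(t)` is not one of the tableaux. -/
noncomputable def projector (r n : ℕ) (μ : YoungDiagram) (i : Fin (n - 1)) :
    Matrix (Tableau r n μ) (Tableau r n μ) ℂ :=
  Matrix.of fun s t =>
    if s = t then (t.alpha i : ℂ)
    else if s.cell = t.swapped i then (t.beta i : ℂ)
    else 0

/-- The matrix `q - (1 + q) e_i`. -/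
noncomputable def sigmaMatrix (r n : ℕ) (μ : YoungDiagram) (i : Fin (n - 1)) :
    Matrix (Tableau r n μ) (Tableau r n μ) ℂ :=
  q r • (1 : Matrix (Tableau r n μ) (Tableau r n μ) ℂ) - (1 + q r) • projector r n μ i

/-! ### Quantum integers -/

section quantum

variable {r : ℕ}

theorem sin_base_pos (hr : 3 ≤ r) : 0 < Real.sin (Real.pi / r) := by
  have h3 : (3 : ℝ) ≤ r := by exact_mod_cast hr
  apply Real.sin_pos_of_pos_of_lt_pi
  · have := Real.pi_pos
    positivity
  · exact div_lt_self Real.pi_pos (by linarith)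

theorem qInt_neg (k : ℤ) : qInt r (-k) = -qInt r k := by
  simp [qInt, neg_div]

theorem qInt_nonneg (hr : 3 ≤ r) {k : ℤ} (h0 : 0 ≤ k) (h1 : k ≤ r) : 0 ≤ qInt r k := by
  have h3 : (3 : ℝ) ≤ r := by exact_mod_cast hr
  have hk0 : (0 : ℝ) ≤ k := by exact_mod_cast h0
  have hk : (k : ℝ) ≤ r := by exact_mod_cast h1
  have := Real.pi_pos
  apply div_nonneg _ (sin_base_pos hr).le
  apply Real.sin_nonneg_of_nonneg_of_le_pi
  · positivity
  · rw [mul_div_assoc', div_le_iff₀ (by linarith)]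
    nlinarith

theorem qInt_pos (hr : 3 ≤ r) {k : ℤ} (h0 : 0 < k) (h1 : k < r) : 0 < qInt r k := by
  have h3 : (3 : ℝ) ≤ r := by exact_mod_cast hr
  have hk0 : (0 : ℝ) < k := by exact_mod_cast h0
  have hk : (k : ℝ) < r := by exact_mod_cast h1
  have := Real.pi_pos
  apply div_pos _ (sin_base_pos hr)
  apply Real.sin_pos_of_pos_of_lt_pi
  · positivity
  · rw [mul_div_assoc', div_lt_iff₀ (by linarith)]
    nlinarith

theorem qInt_ne_zero (hr : 3 ≤ r) {k : ℤ} (h : k ≠ 0) (h0 : -(r : ℤ) < k) (h1 : k < r) :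
    qInt r k ≠ 0 := by
  rcases lt_or_gt_of_ne h with h | h
  · have := qInt_pos hr (k := -k) (by omega) (by omega)
    rw [qInt_neg] at this
    linarith
  · exact (qInt_pos hr h h1).ne'

theorem qInt_one (hr : 3 ≤ r) : qInt r 1 = 1 := by
  simp [qInt, (sin_base_pos hr).ne']

theorem qInt_zero : qInt r 0 = 0 := by simp [qInt]

theorem qInt_two (hr : 3 ≤ r) : qInt r 2 = 2 * Real.cos (Real.pi / r) := by
  have := (sin_base_pos hr).ne'
  rw [qInt]
  push_cast
  rw [Real.sin_two_mul]
  field_simp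

theorem qInt_two_mul (hr : 3 ≤ r) (k : ℤ) :
    qInt r 2 * qInt r k = qInt r (k + 1) + qInt r (k - 1) := by
  rw [qInt_two hr, qInt, qInt, qInt]
  push_cast
  rw [add_mul, sub_mul, Real.sin_add, Real.sin_sub]
  ring_nf

theorem qInt_top_sub (hr : 3 ≤ r) (k : ℤ) : qInt r (r - k) = qInt r k := by
  have h3 : (r : ℝ) ≠ 0 := by positivity
  rw [qInt, qInt]
  congr 1
  rw [← Real.sin_pi_sub]
  congr 1
  push_cast
  field_simp
  ring

/-- `α` as a function of `d`. -/
noncomputable def alphaOf (r : ℕ) (x : ℤ) : ℝ := qInt r (x + 1) / (qInt r 2 * qInt r x)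

theorem two_ne (hr : 3 ≤ r) : qInt r 2 ≠ 0 := qInt_ne_zero hr (by omega) (by omega) (by omega)

theorem alphaOf_neg (hr : 3 ≤ r) {x : ℤ} (hx : qInt r x ≠ 0) :
    alphaOf r (-x) = 1 - alphaOf r x := by
  have h2 := two_ne hr
  have h := qInt_two_mul hr x
  rw [alphaOf, alphaOf, qInt_neg, show -x + 1 = -(x - 1) by ring, qInt_neg]
  field_simp
  linarith

theorem alphaOf_neg_one : alphaOf r (-1) = 0 := by simp [alphaOf, qInt_zero]

theorem alphaOf_one (hr : 3 ≤ r) : alphaOf r 1 = 1 := by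
  have := two_ne hr
  simp [alphaOf, qInt_one hr, this]

theorem alphaOf_bot (hr : 3 ≤ r) : alphaOf r (1 - r) = 1 := by
  have := two_ne hr
  rw [alphaOf, show (1 - (r : ℤ) + 1) = -(r - 2) by ring,
    show (1 - (r : ℤ)) = -(r - 1) by ring, qInt_neg, qInt_neg, qInt_top_sub hr,
    qInt_top_sub hr, qInt_one hr]
  field_simp

theorem alphaOf_mul_nonneg (hr : 3 ≤ r) {x : ℤ} (hx : x ≠ 0) (h0 : -(r : ℤ) < x) (h1 : x < r) :
    0 ≤ alphaOf r x * (1 - alphaOf r x) := by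
  have hne := qInt_ne_zero hr hx h0 h1
  rw [← alphaOf_neg hr hne, alphaOf, alphaOf, qInt_neg,
    show -x + 1 = -(x - 1) by ring, qInt_neg, div_mul_div_comm]
  have key : 0 ≤ qInt r (x + 1) * qInt r (x - 1) := by
    rcases lt_or_gt_of_ne hx with h | h
    · have a := qInt_nonneg hr (k := -(x + 1)) (by omega) (by omega)
      have b := qInt_nonneg hr (k := -(x - 1)) (by omega) (by omega)
      rw [qInt_neg] at a b
      nlinarith
    · exact mul_nonneg (qInt_nonneg hr (by omega) (by omega))
        (qInt_nonneg hr (by omega) (by omega))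
  have e : qInt r (x + 1) * -qInt r (x - 1) / (qInt r 2 * qInt r x * (qInt r 2 * -qInt r x)) =
      qInt r (x + 1) * qInt r (x - 1) / (qInt r 2 * qInt r x) ^ 2 := by
    rw [mul_neg, mul_neg, mul_neg, neg_div_neg_eq, sq]
  rw [e]
  exact div_nonneg key (sq_nonneg _)

theorem alphaOf_braid_left (hr : 3 ≤ r) {x : ℤ} (hx : qInt r x ≠ 0) (hx' : qInt r (x - 1) ≠ 0) :
    alphaOf r (-x) * alphaOf r (x - 1) = (qInt r 2 ^ 2)⁻¹ := by
  have := two_ne hr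
  rw [alphaOf, alphaOf, qInt_neg, show -x + 1 = -(x - 1) by ring, qInt_neg, sub_add_cancel]
  field_simp

theorem alphaOf_braid_right (hr : 3 ≤ r) {x : ℤ} (hx : qInt r x ≠ 0)
    (hx' : qInt r (x + 1) ≠ 0) :
    alphaOf r x * alphaOf r (-1 - x) = (qInt r 2 ^ 2)⁻¹ := by
  have := two_ne hr
  rw [alphaOf, alphaOf, show -1 - x + 1 = -x by ring, show -1 - x = -(x + 1) by ring, qInt_neg,
    qInt_neg]
  field_simp

theorem norm_q (r : ℕ) : q r * star (q r) = 1 := by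
  have e : q r = Complex.exp ((2 * Real.pi / r : ℝ) * Complex.I) := by
    rw [q]
    push_cast
    congr 1
    ring
  have h : ‖q r‖ = 1 := by rw [e, Complex.norm_exp_ofReal_mul_I]
  have := Complex.mul_conj (q r)
  rw [Complex.normSq_eq_norm_sq, h] at this
  simpa using this

theorem q_qInt (hr : 3 ≤ r) : (1 + q r) ^ 2 = q r * ((qInt r 2 : ℝ) : ℂ) ^ 2 := by
  have e : q r = Complex.exp ((Real.pi / r) * Complex.I) ^ 2 := by
    rw [q, ← Complex.exp_nat_mul]
    congr 1
    push_cast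
    ring
  rw [qInt_two hr, e]
  push_cast
  rw [Complex.cos, neg_mul, Complex.exp_neg]
  have := Complex.exp_ne_zero ((Real.pi / r) * Complex.I)
  field_simp
  ring

end quantum

/-! ### Combinatorics of the tableaux -/

/-- The cells filled by the entries below `m` form the two-row shape `[a, b]`. -/
def Shape (r : ℕ) {n : ℕ} {μ : YoungDiagram} (f : Fin n ≃ μ.cells) (m a b : ℕ) : Prop :=
  b ≤ a ∧ a + 2 ≤ b + r ∧ ∀ c : ℕ × ℕ, (∃ j : Fin n, j.val < m ∧ (f j : ℕ × ℕ) = c) ↔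
    (c.1 = 0 ∧ c.2 < a) ∨ (c.1 = 1 ∧ c.2 < b)

theorem exists_shape_iff {r n : ℕ} {μ : YoungDiagram} (f : Fin n ≃ μ.cells) (m : ℕ) :
    (∃ ν : YoungDiagram, IsTwoRow r ν ∧
      ∀ c : ℕ × ℕ, c ∈ ν ↔ ∃ j : Fin n, j.val < m ∧ (f j : ℕ × ℕ) = c) ↔
    ∃ a b, Shape r f m a b := by
  constructor
  · rintro ⟨ν, ⟨h1, h2⟩, h3⟩
    refine ⟨ν.rowLen 0, ν.rowLen 1, ν.rowLen_anti 0 1 (by omega), by omega, ?_⟩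
    rintro ⟨x, y⟩
    rw [← h3]
    constructor
    · intro h
      have hx : x < 2 := by
        have h' : (x, 0) ∈ ν := ν.up_left_mem le_rfl (Nat.zero_le y) h
        rw [YoungDiagram.mem_iff_lt_colLen] at h'
        omega
      rw [YoungDiagram.mem_iff_lt_rowLen] at h
      interval_cases x
      · exact Or.inl ⟨rfl, h⟩
      · exact Or.inr ⟨rfl, h⟩
    · rintro (⟨h, h'⟩ | ⟨h, h'⟩) <;> simp only at h h' <;> subst h <;>
        exact YoungDiagram.mem_iff_lt_rowLen.2 h'
  · rintro ⟨a, b, hab, hr, h⟩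
    have hw : [a, b].SortedGE := by simp [List.sortedGE_iff_pairwise, hab]
    have hmem : ∀ c : ℕ × ℕ, c ∈ YoungDiagram.ofRowLens [a, b] hw ↔
        (c.1 = 0 ∧ c.2 < a) ∨ (c.1 = 1 ∧ c.2 < b) := by
      rintro ⟨x, y⟩
      rw [YoungDiagram.mem_ofRowLens]
      match x with
      | 0 => simp
      | 1 => simp
      | x + 2 => simp
    refine ⟨YoungDiagram.ofRowLens [a, b] hw, ⟨?_, ?_⟩, fun c => by rw [hmem, h]⟩
    · by_contra hc
      have : (2, 0) ∈ YoungDiagram.ofRowLens [a, b] hw :=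
        YoungDiagram.mem_iff_lt_colLen.2 (by omega)
      rw [hmem] at this
      simp at this
    · have h0 := YoungDiagram.rowLen_ofRowLens (w := [a, b]) (hw := hw) ⟨0, by simp⟩
      have h1 := YoungDiagram.rowLen_ofRowLens (w := [a, b]) (hw := hw) ⟨1, by simp⟩
      simp only [Fin.getElem_fin, List.getElem_cons_zero, List.getElem_cons_succ] at h0 h1
      rw [h0, h1]
      omega

namespace Tableau

variable {r n : ℕ} {μ : YoungDiagram}

/-- A filling all of whose truncations have a two-row shape is a tableau. -/
def ofShapes (f : Fin n ≃ μ.cells) (h : ∀ m ≤ n, ∃ a b, Shape r f m a b) : Tableau r n μ where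
  cell := f
  standard j k hjk := by
    obtain ⟨ν, -, hν⟩ := (exists_shape_iff f (k.val + 1)).2 (h _ k.isLt)
    have hk : (f k : ℕ × ℕ) ∈ ν := (hν _).2 ⟨k, by omega, rfl⟩
    have hj : (f j : ℕ × ℕ) ∈ ν := ν.isLowerSet hjk hk
    obtain ⟨l, hl, e⟩ := (hν _).1 hj
    have : l = j := f.injective (Subtype.ext e)
    subst this
    exact Fin.le_def.2 (by omega)
  truncation m hm := (exists_shape_iff f m).2 (h m hm)

theorem shapes (t : Tableau r n μ) (m : ℕ) (hm : m ≤ n) : ∃ a b, Shape r t.cell m a b :=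
  (exists_shape_iff t.cell m).1 (t.truncation m hm)

/-- Each entry is placed at the end of the first or of the second row. -/
theorem step (t : Tableau r n μ) (j : Fin n) {a b : ℕ} (h : Shape r t.cell j.val a b) :
    ((t.cell j : ℕ × ℕ) = (0, a) ∧ Shape r t.cell (j.val + 1) (a + 1) b) ∨
    ((t.cell j : ℕ × ℕ) = (1, b) ∧ Shape r t.cell (j.val + 1) a (b + 1)) := by
  obtain ⟨a', b', h'⟩ := t.shapes (j.val + 1) j.isLt
  have split : ∀ c : ℕ × ℕ, (∃ k : Fin n, k.val < j.val + 1 ∧ (t.cell k : ℕ × ℕ) = c) ↔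
      (∃ k : Fin n, k.val < j.val ∧ (t.cell k : ℕ × ℕ) = c) ∨ (t.cell j : ℕ × ℕ) = c := by
    intro c
    constructor
    · rintro ⟨k, hk, e⟩
      rcases Nat.lt_succ_iff_lt_or_eq.1 hk with hk | hk
      · exact Or.inl ⟨k, hk, e⟩
      · have : k = j := Fin.ext hk
        subst this
        exact Or.inr e
    · rintro (⟨k, hk, e⟩ | e)
      · exact ⟨k, by omega, e⟩
      · exact ⟨j, by omega, e⟩
  have hnot : ¬ ∃ k : Fin n, k.val < j.val ∧ (t.cell k : ℕ × ℕ) = t.cell j := by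
    rintro ⟨k, hk, e⟩
    have : k = j := t.cell.injective (Subtype.ext e)
    subst this
    omega
  rw [h.2.2] at hnot
  have key : ∀ x y : ℕ, ((x = 0 ∧ y < a') ∨ (x = 1 ∧ y < b')) ↔
      ((x = 0 ∧ y < a) ∨ (x = 1 ∧ y < b)) ∨ (t.cell j : ℕ × ℕ) = (x, y) := by
    intro x y
    have := split (x, y)
    rw [h.2.2, h'.2.2] at this
    exact this
  generalize (t.cell j : ℕ × ℕ) = p at *
  obtain ⟨x, y⟩ := p
  simp only [Prod.mk.injEq] at *
  have k0 := (key x y).2 (Or.inr ⟨rfl, rfl⟩)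
  rcases k0 with ⟨rfl, hy⟩ | ⟨rfl, hy⟩
  · left
    have hya : y = a := by
      have := key 0 a
      by_contra hne
      have : ¬ a < a' := by
        intro hlt
        have := (key 0 a).1 (Or.inl ⟨rfl, hlt⟩)
        omega
      omega
    subst hya
    have ha : a' = y + 1 := by
      have := key 0 (y + 1)
      omega
    have hb : b' = b := by
      have h1 := key 1 b
      have h2 := key 1 b'
      omega
    subst ha hb
    exact ⟨⟨rfl, rfl⟩, h'⟩
  · right
    have hyb : y = b := by
      have h1 := key 1 b
      omega
    subst hyb
    have hb : b' = y + 1 := by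
      have := key 1 (y + 1)
      omega
    have ha : a' = a := by
      have h1 := key 0 a
      have h2 := key 0 a'
      omega
    subst ha hb
    exact ⟨⟨rfl, rfl⟩, h'⟩

theorem d_bounds (t : Tableau r n μ) (i : Fin (n - 1)) :
    t.d i ≠ 0 ∧ -(r : ℤ) < t.d i ∧ t.d i < r := by
  obtain ⟨a, b, h⟩ := t.shapes i.val (by omega)
  have hs := h.1
  have hs' := h.2.1
  rcases t.step (lo i) h with ⟨e1, h1⟩ | ⟨e1, h1⟩ <;>
    rcases t.step (hi i) h1 with ⟨e2, h2⟩ | ⟨e2, h2⟩ <;>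
    (have g1 := h1.1; have g2 := h1.2.1; have g3 := h2.1; have g4 := h2.2.1
     rw [d, e1, e2]; push_cast; refine ⟨?_, ?_, ?_⟩ <;> omega)

theorem d_three (t : Tableau r n μ) (i j : Fin (n - 1)) (hij : i.val + 1 = j.val) :
    (t.d i = -1 ∧ t.d j ≠ 1 ∧ t.d j ≠ 1 - r) ∨ (t.d j = -1 ∧ t.d i ≠ 1 ∧ t.d i ≠ 1 - r) ∨
      t.d i + t.d j = -1 := by
  obtain ⟨a, b, h⟩ := t.shapes i.val (by omega)
  have hs := h.1
  have hs' := h.2.1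
  have hlo : lo j = hi i := Fin.ext hij.symm
  have hhj : (hi j).val = (hi i).val + 1 := by simp [hi, hij]
  rcases t.step (lo i) h with ⟨e1, h1⟩ | ⟨e1, h1⟩ <;>
    rcases t.step (hi i) h1 with ⟨e2, h2⟩ | ⟨e2, h2⟩ <;>
    rw [← hhj] at h2 <;>
    rcases t.step (hi j) h2 with ⟨e3, h3⟩ | ⟨e3, h3⟩ <;>
    (have g1 := h1.1; have g2 := h1.2.1; have g3 := h2.1; have g4 := h2.2.1
     have g5 := h3.1; have g6 := h3.2.1
     rw [d, d, hlo, e1, e2, e3]; push_cast; omega)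

theorem swapped_shape (t : Tableau r n μ) (i : Fin (n - 1)) {m a b : ℕ} (hm : m ≠ i.val + 1)
    (h : Shape r t.cell m a b) : Shape r (t.swapped i) m a b := by
  refine ⟨h.1, h.2.1, fun c => ?_⟩
  rw [← h.2.2 c]
  have key : ∀ k : Fin n, k.val < m → (Equiv.swap (lo i) (hi i) k).val < m := by
    intro k hk
    rw [Equiv.swap_apply_def]
    split_ifs with h1 h2
    · have := congrArg Fin.val h1
      simp only [lo, hi] at *
      omega
    · have := congrArg Fin.val h2
      simp only [lo, hi] at *
      omega
    · exact hk
  constructor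
  · rintro ⟨k, hk, e⟩
    exact ⟨_, key k hk, e⟩
  · rintro ⟨k, hk, e⟩
    exact ⟨_, key k hk, by simpa [swapped] using e⟩

/-- The exchange gives a tableau unless `d` takes one of three extreme values. -/
theorem exists_swap (t : Tableau r n μ) (i : Fin (n - 1)) (h1 : t.d i ≠ -1) (h2 : t.d i ≠ 1)
    (h3 : t.d i ≠ 1 - r) : ∃ s : Tableau r n μ, s.cell = t.swapped i := by
  suffices H : ∃ a b, Shape r (t.swapped i) (i.val + 1) a b by
    refine ⟨ofShapes (t.swapped i) fun m hm => ?_, rfl⟩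
    by_cases e : m = i.val + 1
    · rw [e]
      exact H
    · obtain ⟨a, b, h⟩ := t.shapes m hm
      exact ⟨a, b, t.swapped_shape i e h⟩
  obtain ⟨a, b, h⟩ := t.shapes i.val (by omega)
  have hs := h.1
  have hs' := h.2.1
  have hsw := t.swapped_shape i (m := i.val) (by omega) h
  have hset : ∀ c : ℕ × ℕ,
      (∃ k : Fin n, k.val < i.val + 1 ∧ (t.swapped i k : ℕ × ℕ) = c) ↔
      ((c.1 = 0 ∧ c.2 < a) ∨ (c.1 = 1 ∧ c.2 < b)) ∨ (t.cell (hi i) : ℕ × ℕ) = c := by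
    intro c
    rw [← hsw.2.2]
    have e : t.swapped i (lo i) = t.cell (hi i) := by simp [swapped]
    constructor
    · rintro ⟨k, hk, e'⟩
      rcases Nat.lt_succ_iff_lt_or_eq.1 hk with hk | hk
      · exact Or.inl ⟨k, hk, e'⟩
      · have : k = lo i := Fin.ext hk
        subst this
        exact Or.inr (by rw [← e, e'])
    · rintro (⟨k, hk, e'⟩ | e')
      · exact ⟨k, by omega, e'⟩
      · exact ⟨lo i, by simp [lo], by rw [e, e']⟩
  rcases t.step (lo i) h with ⟨e1, g1⟩ | ⟨e1, g1⟩ <;>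
    rcases t.step (hi i) g1 with ⟨e2, g2⟩ | ⟨e2, g2⟩ <;>
    (rw [d, e1, e2] at h1 h2 h3; push_cast at h1 h2 h3)
  · omega
  · refine ⟨a, b + 1, by omega, by omega, ?_⟩
    rintro ⟨x, y⟩
    rw [hset, e2]
    simp only [Prod.mk.injEq]
    omega
  · have := g2.2.1
    refine ⟨a + 1, b, by omega, by omega, ?_⟩
    rintro ⟨x, y⟩
    rw [hset, e2]
    simp only [Prod.mk.injEq]
    omega
  · omega

open Classical in
/-- The exchange of `i` and `i+1`, where it is defined. -/
noncomputable def G (i : Fin (n - 1)) (t : Tableau r n μ) : Tableau r n μ :=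
  if h : ∃ s : Tableau r n μ, s.cell = t.swapped i then h.choose else t

theorem G_spec (i : Fin (n - 1)) (t : Tableau r n μ)
    (h : ∃ s : Tableau r n μ, s.cell = t.swapped i) : (G i t).cell = t.swapped i := by
  rw [G, dif_pos h]
  exact h.choose_spec

theorem alpha_eq (t : Tableau r n μ) (i : Fin (n - 1)) : t.alpha i = alphaOf r (t.d i) := rfl

theorem qInt_d (hr : 3 ≤ r) (t : Tableau r n μ) (i : Fin (n - 1)) : qInt r (t.d i) ≠ 0 :=
  qInt_ne_zero hr (t.d_bounds i).1 (t.d_bounds i).2.1 (t.d_bounds i).2.2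

theorem beta_sq (hr : 3 ≤ r) (t : Tableau r n μ) (i : Fin (n - 1)) :
    t.beta i * t.beta i = t.alpha i * (1 - t.alpha i) := by
  rw [beta, Real.mul_self_sqrt]
  rw [alpha_eq]
  exact alphaOf_mul_nonneg hr (t.d_bounds i).1 (t.d_bounds i).2.1 (t.d_bounds i).2.2

theorem extreme (hr : 3 ≤ r) (t : Tableau r n μ) (i : Fin (n - 1))
    (h : ¬ ∃ s : Tableau r n μ, s.cell = t.swapped i) :
    t.d i = -1 ∧ t.alpha i = 0 ∧ t.beta i = 0 ∨
    (t.d i = 1 ∨ t.d i = 1 - r) ∧ t.alpha i = 1 ∧ t.beta i = 0 := by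
  by_cases h1 : t.d i = -1
  · have : t.alpha i = 0 := by rw [alpha_eq, h1, alphaOf_neg_one]
    exact Or.inl ⟨h1, this, by simp [beta, this]⟩
  · have h2 : t.d i = 1 ∨ t.d i = 1 - r := by
      by_contra h2
      push Not at h2
      exact h (t.exists_swap i h1 h2.1 h2.2)
    have : t.alpha i = 1 := by
      rw [alpha_eq]
      rcases h2 with h2 | h2
      · rw [h2, alphaOf_one hr]
      · rw [h2, alphaOf_bot hr]
    exact Or.inr ⟨h2, this, by simp [beta, this]⟩

theorem d_of_swapped {s t : Tableau r n μ} {i : Fin (n - 1)} (h : s.cell = t.swapped i) :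
    s.d i = -t.d i := by
  have h1 : s.cell (lo i) = t.cell (hi i) := by simp [h, swapped]
  have h2 : s.cell (hi i) = t.cell (lo i) := by simp [h, swapped]
  rw [d, d, h1, h2]
  ring

theorem d_of_swapped_far {s t : Tableau r n μ} {i j : Fin (n - 1)} (h : s.cell = t.swapped i)
    (hij : i.val + 1 < j.val ∨ j.val + 1 < i.val) : s.d j = t.d j := by
  have h1 : s.cell (lo j) = t.cell (lo j) := by
    simp only [h, swapped, Equiv.trans_apply]
    rw [Equiv.swap_apply_of_ne_of_ne] <;> simp only [lo, hi, ne_eq, Fin.mk.injEq] <;> omega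
  have h2 : s.cell (hi j) = t.cell (hi j) := by
    simp only [h, swapped, Equiv.trans_apply]
    rw [Equiv.swap_apply_of_ne_of_ne] <;> simp only [lo, hi, ne_eq, Fin.mk.injEq] <;> omega
  rw [d, d, h1, h2]

theorem d_of_swapped_near {s t : Tableau r n μ} {i j : Fin (n - 1)} (h : s.cell = t.swapped i)
    (hij : i.val + 1 = j.val ∨ j.val + 1 = i.val) : s.d j = t.d i + t.d j := by
  rcases hij with hij | hij
  · have e : lo j = hi i := Fin.ext hij.symm
    have h1 : s.cell (lo j) = t.cell (lo i) := by simp [h, swapped, e]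
    have h2 : s.cell (hi j) = t.cell (hi j) := by
      simp only [h, swapped, Equiv.trans_apply]
      rw [Equiv.swap_apply_of_ne_of_ne] <;> simp only [lo, hi, ne_eq, Fin.mk.injEq] <;> omega
    rw [d, d, d, h1, h2, e]
    ring
  · have e : lo i = hi j := Fin.ext hij.symm
    have h1 : s.cell (hi j) = t.cell (hi i) := by simp [h, swapped, e]
    have h2 : s.cell (lo j) = t.cell (lo j) := by
      simp only [h, swapped, Equiv.trans_apply]
      rw [Equiv.swap_apply_of_ne_of_ne] <;> simp only [lo, hi, ne_eq, Fin.mk.injEq] <;> omega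
    rw [d, d, d, h1, h2, e]
    ring

theorem swapped_symm {s t : Tableau r n μ} {i : Fin (n - 1)} (h : s.cell = t.swapped i) :
    t.cell = s.swapped i := by
  apply Equiv.ext
  intro k
  simp [swapped, h]

theorem alpha_of_swapped (hr : 3 ≤ r) {s t : Tableau r n μ} {i : Fin (n - 1)}
    (h : s.cell = t.swapped i) : s.alpha i = 1 - t.alpha i := by
  rw [alpha_eq, d_of_swapped h, alphaOf_neg hr (qInt_d hr t i), alpha_eq]

theorem beta_of_swapped (hr : 3 ≤ r) {s t : Tableau r n μ} {i : Fin (n - 1)}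
    (h : s.cell = t.swapped i) : s.beta i = t.beta i := by
  rw [beta, beta, alpha_of_swapped hr h]
  congr 1
  ring

theorem not_swapped_self (t : Tableau r n μ) (i : Fin (n - 1)) : t.cell ≠ t.swapped i := by
  intro h
  have h1 : t.cell (lo i) = t.cell (hi i) := by
    conv_lhs => rw [h]
    simp [swapped]
  have := congrArg Fin.val (t.cell.injective h1)
  simp [lo, hi] at this

end Tableau

/-! ### The Temperley-Lieb-Jones relations -/

section relations

variable {r n : ℕ} {μ : YoungDiagram}

open Tableau

theorem projector_mulVec (hr : 3 ≤ r) (i : Fin (n - 1)) (f : Tableau r n μ → ℂ)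
    (t : Tableau r n μ) :
    (projector r n μ i).mulVec f t = t.alpha i * f t + t.beta i * f (G i t) := by
  rw [Matrix.mulVec, dotProduct]
  by_cases h : ∃ s : Tableau r n μ, s.cell = t.swapped i
  · have hG := G_spec i t h
    have hne : t ≠ G i t := fun e => not_swapped_self t i (by rw [← hG, ← e])
    rw [Fintype.sum_eq_add t (G i t) hne]
    · simp only [projector, Matrix.of_apply, if_true, if_neg hne, if_pos (swapped_symm hG),
        beta_of_swapped hr hG]
    · rintro s ⟨h1, h2⟩
      have h3 : ¬ t.cell = s.swapped i := fun e =>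
        h2 (Tableau.ext ((swapped_symm e).trans hG.symm))
      simp [projector, h1.symm, h3]
  · have hb : t.beta i = 0 := by rcases extreme hr t i h with h | h <;> exact h.2.2
    rw [Fintype.sum_eq_single t]
    · simp [projector, hb]
    · intro s hs
      have h3 : ¬ t.cell = s.swapped i := fun e => h ⟨s, swapped_symm e⟩
      simp [projector, hs.symm, h3]

theorem beta_mul_projector (hr : 3 ≤ r) (i : Fin (n - 1)) (f : Tableau r n μ → ℂ)
    (t : Tableau r n μ) :
    (t.beta i : ℂ) * (projector r n μ i).mulVec f (G i t) =
      (1 - t.alpha i) * (projector r n μ i).mulVec f t := by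
  rw [projector_mulVec hr, projector_mulVec hr]
  by_cases h : ∃ s : Tableau r n μ, s.cell = t.swapped i
  · have hG := G_spec i t h
    have hGG : G i (G i t) = t := by
      apply Tableau.ext
      rw [G_spec i (G i t) ⟨t, swapped_symm hG⟩, ← swapped_symm hG]
    have hb : (t.beta i : ℂ) * t.beta i = t.alpha i * (1 - t.alpha i) := by
      exact_mod_cast beta_sq hr t i
    rw [hGG, alpha_of_swapped hr hG, beta_of_swapped hr hG]
    push_cast
    linear_combination f t * hb
  · rcases extreme hr t i h with h | h <;> simp [h.2.1, h.2.2]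

theorem projector_mul_self (hr : 3 ≤ r) (i : Fin (n - 1)) :
    projector r n μ i * projector r n μ i = projector r n μ i := by
  apply Matrix.ext_of_mulVec_single
  intro k
  ext t
  rw [← Matrix.mulVec_mulVec, projector_mulVec hr, beta_mul_projector hr]
  ring

theorem projector_comm (hr : 3 ≤ r) (i j : Fin (n - 1))
    (hij : i.val + 1 < j.val ∨ j.val + 1 < i.val) :
    projector r n μ i * projector r n μ j = projector r n μ j * projector r n μ i := by
  apply Matrix.ext_of_mulVec_single
  intro k
  ext t
  generalize (Pi.single k 1 : Tableau r n μ → ℂ) = f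
  rw [← Matrix.mulVec_mulVec, ← Matrix.mulVec_mulVec]
  simp only [projector_mulVec hr]
  by_cases hi' : ∃ s : Tableau r n μ, s.cell = t.swapped i
  · have hGi := G_spec i t hi'
    have dj := d_of_swapped_far hGi hij
    have aj : (G i t).alpha j = t.alpha j := by rw [alpha_eq, dj, alpha_eq]
    have bj : (G i t).beta j = t.beta j := by rw [beta, aj, beta]
    by_cases hj' : ∃ s : Tableau r n μ, s.cell = t.swapped j
    · have hGj := G_spec j t hj'
      have di := d_of_swapped_far hGj hij.symm
      have ai : (G j t).alpha i = t.alpha i := by rw [alpha_eq, di, alpha_eq]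
      have bi : (G j t).beta i = t.beta i := by rw [beta, ai, beta]
      rw [aj, bj, ai, bi]
      by_cases hij' : ∃ s : Tableau r n μ, s.cell = (G i t).swapped j
      · by_cases hji' : ∃ s : Tableau r n μ, s.cell = (G j t).swapped i
        · have e : G j (G i t) = G i (G j t) := by
            apply Tableau.ext
            rw [G_spec j _ hij', G_spec i _ hji', swapped, swapped, hGi, hGj, swapped, swapped]
            apply Equiv.ext
            intro k
            have hc : Equiv.swap (lo i) (hi i) * Equiv.swap (lo j) (hi j) =
                Equiv.swap (lo j) (hi j) * Equiv.swap (lo i) (hi i) := by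
              apply Equiv.Perm.Disjoint.commute
              apply Equiv.Perm.disjoint_swap_swap
              simp only [lo, hi]
              refine List.nodup_cons.2 ⟨?_, ?_⟩ <;> simp <;> omega
            have := congrArg (fun p : Equiv.Perm (Fin n) => t.cell (p k)) hc
            simpa using this
          rw [e]
          ring
        · have hb : t.beta i = 0 := by
            rw [← bi]
            rcases extreme hr _ i hji' with h | h <;> exact h.2.2
          simp [hb]
          ring
      · have hb : t.beta j = 0 := by
          rw [← bj]
          rcases extreme hr _ j hij' with h | h <;> exact h.2.2
        simp [hb]
        ring
    · have hb : t.beta j = 0 := by rcases extreme hr _ j hj' with h | h <;> exact h.2.2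
      rw [aj, bj, hb]
      push_cast
      ring
  · have hb : t.beta i = 0 := by rcases extreme hr _ i hi' with h | h <;> exact h.2.2
    by_cases hj' : ∃ s : Tableau r n μ, s.cell = t.swapped j
    · have hGj := G_spec j t hj'
      have di := d_of_swapped_far hGj hij.symm
      have ai : (G j t).alpha i = t.alpha i := by rw [alpha_eq, di, alpha_eq]
      have bi : (G j t).beta i = t.beta i := by rw [beta, ai, beta]
      rw [ai, bi, hb]
      push_cast
      ring
    · have hb' : t.beta j = 0 := by rcases extreme hr _ j hj' with h | h <;> exact h.2.2
      rw [hb, hb']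
      push_cast
      ring

/-- The entries `i`, `i+1` in one row are killed by the projector. -/
theorem projector_eq_zero (hr : 3 ≤ r) (i : Fin (n - 1)) (f : Tableau r n μ → ℂ)
    (t : Tableau r n μ) (h : t.d i = -1) : (projector r n μ i).mulVec f t = 0 := by
  have ha : t.alpha i = 0 := by rw [alpha_eq, h, alphaOf_neg_one]
  have hb : t.beta i = 0 := by simp [beta, ha]
  rw [projector_mulVec hr, ha, hb]
  simp

theorem projector_inner (hr : 3 ≤ r) (i j : Fin (n - 1))
    (hij : i.val + 1 = j.val ∨ j.val + 1 = i.val) (f : Tableau r n μ → ℂ)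
    (s : Tableau r n μ) (hs : s.d j = -1 ∨ s.d i + s.d j = -1) :
    (projector r n μ j).mulVec ((projector r n μ i).mulVec f) s =
      s.alpha j * (projector r n μ i).mulVec f s := by
  by_cases h1 : s.d j = -1
  · rw [projector_eq_zero hr j _ s h1, alpha_eq, h1, alphaOf_neg_one]
    simp
  · rw [projector_mulVec hr j]
    by_cases h : ∃ u : Tableau r n μ, u.cell = s.swapped j
    · have hG := G_spec j s h
      have : (G j s).d i = -1 := by
        rw [d_of_swapped_near hG hij.symm]
        omega
      rw [projector_eq_zero hr i _ _ this]
      ring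
    · have hb : s.beta j = 0 := by rcases extreme hr _ j h with h | h <;> exact h.2.2
      rw [hb]
      push_cast
      ring

theorem projector_braid (hr : 3 ≤ r) (i j : Fin (n - 1))
    (hij : i.val + 1 = j.val ∨ j.val + 1 = i.val) :
    projector r n μ i * projector r n μ j * projector r n μ i =
      (((qInt r 2 : ℝ) : ℂ) ^ 2)⁻¹ • projector r n μ i := by
  apply Matrix.ext_of_mulVec_single
  intro k
  ext t
  generalize (Pi.single k 1 : Tableau r n μ → ℂ) = f
  rw [← Matrix.mulVec_mulVec, ← Matrix.mulVec_mulVec, Matrix.smul_mulVec, Pi.smul_apply,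
    smul_eq_mul]
  by_cases h0 : t.d i = -1
  · rw [projector_eq_zero hr i _ t h0, projector_eq_zero hr i _ t h0, mul_zero]
  have h3 : (t.d j = -1 ∧ t.d i ≠ 1 ∧ t.d i ≠ 1 - r) ∨ t.d i + t.d j = -1 := by
    rcases hij with hij | hij
    · have := d_three t i j hij
      tauto
    · have := d_three t j i hij
      rw [add_comm] at this
      tauto
  have hbr : (t.alpha i : ℂ) * t.alpha j + (1 - t.alpha i) *
      (if ∃ s : Tableau r n μ, s.cell = t.swapped i then ((G i t).alpha j : ℂ) else 0) =
      (((qInt r 2 : ℝ) : ℂ) ^ 2)⁻¹ := by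
    have hq := qInt_d hr t i
    rcases h3 with ⟨h3, h4, h5⟩ | h3
    · have hex := t.exists_swap i h0 h4 h5
      have hG := G_spec i t hex
      have hd : (G i t).d j = t.d i - 1 := by
        rw [d_of_swapped_near hG hij, h3]
        ring
      have hq' := qInt_d hr (G i t) j
      rw [hd] at hq'
      have := alphaOf_braid_left hr hq hq'
      rw [alphaOf_neg hr hq] at this
      rw [if_pos hex, alpha_eq, alpha_eq, alpha_eq, hd, h3, alphaOf_neg_one]
      have h' := congrArg (fun x : ℝ => (x : ℂ)) this
      push_cast at h'
      rw [← h']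
      push_cast
      ring
    · have hj : t.d j = -1 - t.d i := by omega
      have hq' := qInt_d hr t j
      rw [hj, show -1 - t.d i = -(t.d i + 1) by ring, qInt_neg] at hq'
      have := alphaOf_braid_right hr hq (neg_ne_zero.1 hq')
      have h' := congrArg (fun x : ℝ => (x : ℂ)) this
      push_cast at h'
      rw [← h', alpha_eq t j, hj, alpha_eq]
      split_ifs with hex
      · have hG := G_spec i t hex
        rw [alpha_eq, d_of_swapped_near hG hij, h3, alphaOf_neg_one]
        push_cast
        ring
      · ring
  rw [projector_mulVec hr i, projector_inner hr i j hij f t (by tauto), ← hbr]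
  by_cases hex : ∃ s : Tableau r n μ, s.cell = t.swapped i
  · have hG := G_spec i t hex
    have d1 := d_of_swapped hG
    have d2 := d_of_swapped_near hG hij
    rw [projector_inner hr i j hij f (G i t) (by omega), if_pos hex]
    have := beta_mul_projector hr i f t
    linear_combination ((G i t).alpha j : ℂ) * this
  · have hb : t.beta i = 0 := by rcases extreme hr _ i hex with h | h <;> exact h.2.2
    rw [hb, if_neg hex]
    push_cast
    ring

theorem projector_star (hr : 3 ≤ r) (i : Fin (n - 1)) :
    star (projector r n μ i) = projector r n μ i := by
  ext s t
  rw [Matrix.star_apply]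
  simp only [projector, Matrix.of_apply]
  by_cases h : s = t
  · simp [h]
  · rw [if_neg h, if_neg (Ne.symm h)]
    by_cases h' : s.cell = t.swapped i
    · rw [if_pos h', if_pos (swapped_symm h'), beta_of_swapped hr h']
      simp
    · rw [if_neg h', if_neg fun e => h' (swapped_symm e)]
      simp

theorem sigmaMatrix_mem (hr : 3 ≤ r) (i : Fin (n - 1)) :
    sigmaMatrix r n μ i ∈ Matrix.unitaryGroup (Tableau r n μ) ℂ := by
  rw [Matrix.mem_unitaryGroup_iff, sigmaMatrix, star_sub, star_smul, star_smul, star_one,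
    projector_star hr]
  have hq := norm_q r
  have hp := projector_mul_self (μ := μ) hr i
  simp only [sub_mul, mul_sub, smul_mul_assoc, mul_smul_comm, one_mul, mul_one, hp]
  rw [star_add, star_one]
  match_scalars
  · linear_combination hq
  · linear_combination -hq

theorem sigmaMatrix_comm (hr : 3 ≤ r) (i j : Fin (n - 1))
    (hij : i.val + 1 < j.val ∨ j.val + 1 < i.val) :
    sigmaMatrix r n μ i * sigmaMatrix r n μ j = sigmaMatrix r n μ j * sigmaMatrix r n μ i := by
  have h := projector_comm (μ := μ) hr i j hij
  simp only [sigmaMatrix, sub_mul, mul_sub, smul_mul_assoc, mul_smul_comm, one_mul, mul_one, h]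
  module

theorem sigmaMatrix_braid (hr : 3 ≤ r) (i j : Fin (n - 1))
    (hij : i.val + 1 = j.val ∨ j.val + 1 = i.val) :
    sigmaMatrix r n μ i * sigmaMatrix r n μ j * sigmaMatrix r n μ i =
      sigmaMatrix r n μ j * sigmaMatrix r n μ i * sigmaMatrix r n μ j := by
  have h1 := projector_braid (μ := μ) hr i j hij
  have h2 := projector_braid (μ := μ) hr j i hij.symm
  have p1 := projector_mul_self (μ := μ) hr i
  have p2 := projector_mul_self (μ := μ) hr j
  have h2q : ((qInt r 2 : ℝ) : ℂ) ≠ 0 := by exact_mod_cast two_ne hr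
  have hc : (1 + q r) ^ 2 * (((qInt r 2 : ℝ) : ℂ) ^ 2)⁻¹ = q r := by
    rw [q_qInt hr]
    field_simp
  simp only [sigmaMatrix, sub_mul, mul_sub, smul_mul_assoc, mul_smul_comm, one_mul, mul_one,
    smul_smul, h1, h2, p1, p2, smul_sub]
  match_scalars
  all_goals first
    | ring1
    | linear_combination (1 + q r) * hc
    | linear_combination (-(1 + q r)) * hc

end relations

/-! ### The sectors -/

/-- The images of the generators as unitary matrices. -/
noncomputable def sigmaUnitary (r n : ℕ) (hr : 3 ≤ r) (μ : YoungDiagram) (i : Fin (n - 1)) :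
    Matrix.unitaryGroup (Tableau r n μ) ℂ :=
  ⟨sigmaMatrix r n μ i, sigmaMatrix_mem hr i⟩

theorem sigmaUnitary_rels (r n : ℕ) (hr : 3 ≤ r) (μ : YoungDiagram) :
    ∀ w ∈ braidRels n, FreeGroup.lift (sigmaUnitary r n hr μ) w = 1 := by
  rintro w (⟨i, j, hij, rfl⟩ | ⟨i, j, hij, rfl⟩)
  · simp only [map_mul, map_inv, FreeGroup.lift_apply_of]
    rw [mul_inv_eq_one, mul_inv_eq_iff_eq_mul]
    exact Subtype.ext (sigmaMatrix_comm hr i j hij)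
  · simp only [map_mul, map_inv, FreeGroup.lift_apply_of]
    rw [mul_inv_eq_one]
    exact Subtype.ext (sigmaMatrix_braid hr i j hij)

/-- The sector `ρ_{λ,β,n} : B_n → U(V_λ)` of the Jones representation at `q = e^{2πi/r}`, in the
orthonormal basis `v_t`: it sends `σ_i` to `q - (1 + q) e_i`. -/
noncomputable def sector (r n : ℕ) (hr : 3 ≤ r) (μ : YoungDiagram) :
    BraidGroup n →* Matrix.unitaryGroup (Tableau r n μ) ℂ :=
  PresentedGroup.toGroup (sigmaUnitary_rels r n hr μ)

/-- The sector as a linear representation on the space `V_λ` of functions on the tableaux. -/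
noncomputable def sectorRep (r n : ℕ) (hr : 3 ≤ r) (μ : YoungDiagram) :
    Representation ℂ (BraidGroup n) (Tableau r n μ → ℂ) :=
  (MonoidHomClass.toMonoidHom
    (Matrix.toLinAlgEquiv' : Matrix (Tableau r n μ) (Tableau r n μ) ℂ ≃ₐ[ℂ] _)).comp
    ((Matrix.unitaryGroup (Tableau r n μ) ℂ).subtype.comp (sector r n hr μ))

/-- The subgroup of `U(V_λ)` generated by the images of the first two generators `σ_1`, `σ_2`. -/
noncomputable def firstTwo (r n : ℕ) (hr : 3 ≤ r) (hn : 3 ≤ n) (μ : YoungDiagram) :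
    Subgroup (Matrix.unitaryGroup (Tableau r n μ) ℂ) :=
  Subgroup.closure {sector r n hr μ (BraidGroup.σ ⟨0, by omega⟩),
    sector r n hr μ (BraidGroup.σ ⟨1, by omega⟩)}

/-- The Young diagram `[4, 2]`. -/
def diagram42 : YoungDiagram :=
  YoungDiagram.ofRowLens [4, 2] (by simp [List.sortedGE_iff_pairwise])

end JonesSector

/-! A tableau is read as a lattice path: an entry in the first row is an up-step, an entry in the
second row a down-step. The height `λ₁ - λ₂` of each truncation stays in `[0, r - 2]`, and `|d|` at
a peak or valley is the height before it plus one.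

Irreducibility. Let `J_k` be the diagonal operator with entry `q ^ content` of the box holding `k`
(a Jucys-Murphy operator). Then `J_0 = 1` and `σ_i J_i σ_i = q J_{i+1}` (`sigmaMatrix_content`), so
an invariant subspace is stable under every `J_k`. At the first entry where two tableaux differ, the
two possible contents differ by an integer in `[1, r - 1]`, so the `J_k` separate the basis vectors
(`exists_q_content_ne`), and a nonzero invariant subspace contains some `v_t` (`single_mem`). The
coefficient `β` is nonzero at every admissible exchange (`beta_ne_zero`), and exchanges connect all
tableaux (`forall_mem_of_swapped`), so the subspace is everything.

Infinite image. The projections `E = e_1`, `F = e_2` preserve the plane spanned by a vector `v` in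
the range of `E` and by `F v`. There `g = σ₁ σ₂⁻¹` has determinant `1` and trace `1 - q - q⁻¹`, so
its eigenvalues are `x`, `x⁻¹` with `x + x⁻¹ = 1 - q - q⁻¹`. If a positive power of `g` were
central, it would be scalar on the plane and `x` would be a root of unity
(`pow_two_mul_eq_one_of_commute`). For the allowed `r` some `k` prime to `r` has `Re q ^ k < -1/2`;
the Galois conjugation `q ↦ q ^ k` would turn `x` into a root of unity `y` with `y + y⁻¹ > 2`, which
is absurd (`not_isRoot_of_unity`).

Eigenvalues. `σ_i` is `-1` on the range of `e_i` and `q` on its kernel. The relation `e_i e_j e_i =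
[2]⁻² e_i` for neighbours shows that `e_i` is neither `0` nor `1`, and that all `e_i` have the same
trace. The trace of `e_1` counts the tableaux with `2` below `1`, and for `[4, 2]` this is a finite
count. -/

namespace JonesSector

/-! ### Tableaux as row words -/

namespace Tableau

variable {r n : ℕ} {μ : YoungDiagram}

/-- Whether the entry `j` of `t` sits in the second row (`false` if there is no such entry). -/
def inSecond (t : Tableau r n μ) (j : ℕ) : Bool :=
  if h : j < n then decide ((t.cell ⟨j, h⟩ : ℕ × ℕ).1 = 1) else false

/-- The number of entries below `m` in the second row. -/
def downs (t : Tableau r n μ) (m : ℕ) : ℕ := Nat.count (fun j => t.inSecond j = true) m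

theorem downs_zero (t : Tableau r n μ) : t.downs 0 = 0 := by simp [downs]

theorem downs_succ (t : Tableau r n μ) (m : ℕ) :
    t.downs (m + 1) = t.downs m + if t.inSecond m = true then 1 else 0 := by
  rw [downs, Nat.count_succ, downs]

theorem downs_congr {s t : Tableau r n μ} {m : ℕ} (h : ∀ j < m, s.inSecond j = t.inSecond j) :
    s.downs m = t.downs m := by
  induction m with
  | zero => rw [downs_zero, downs_zero]
  | succ m ih => rw [downs_succ, downs_succ, ih fun j hj => h j (by omega), h m (by omega)]

/-- By `step` each entry extends one of the two rows, and `downs` records which. This turns the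
conditions on shapes into inequalities on the partial counts of the row word. -/
theorem shape_downs (t : Tableau r n μ) {m : ℕ} (hm : m ≤ n) :
    Shape r t.cell m (m - t.downs m) (t.downs m) := by
  induction m with
  | zero =>
    obtain ⟨a, b, h⟩ := t.shapes 0 hm
    have ha : a = 0 := by
      by_contra ha
      obtain ⟨j, hj, -⟩ := (h.2.2 (0, 0)).2 (Or.inl ⟨rfl, by omega⟩)
      omega
    have hb : b = 0 := by have := h.1; omega
    subst ha hb
    simpa [downs_zero] using h
  | succ m ih =>
    have h := ih (by omega)
    have h1 := h.1
    have e : t.inSecond m = decide ((t.cell ⟨m, hm⟩ : ℕ × ℕ).1 = 1) := by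
      rw [inSecond, dif_pos (show m < n from hm)]
    rcases t.step ⟨m, hm⟩ h with ⟨e1, g⟩ | ⟨e1, g⟩
    · rw [e1] at e
      have e2 : t.downs (m + 1) = t.downs m := by simp [downs_succ, e]
      rw [e2]
      convert g using 1
      omega
    · rw [e1] at e
      have e2 : t.downs (m + 1) = t.downs m + 1 := by simp [downs_succ, e]
      rw [e2]
      convert g using 1
      omega

theorem two_mul_downs_le (t : Tableau r n μ) {m : ℕ} (hm : m ≤ n) : 2 * t.downs m ≤ m := by
  have := (t.shape_downs hm).1
  omega

theorem le_two_mul_downs (t : Tableau r n μ) {m : ℕ} (hm : m ≤ n) :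
    m + 2 ≤ 2 * t.downs m + r := by
  have h1 := (t.shape_downs hm).1
  have h2 := (t.shape_downs hm).2.1
  omega

theorem cell_of_second (t : Tableau r n μ) (j : Fin n) (h : t.inSecond j = true) :
    (t.cell j : ℕ × ℕ) = (1, t.downs j) := by
  have e : t.inSecond j = decide ((t.cell j : ℕ × ℕ).1 = 1) := by rw [inSecond, dif_pos j.isLt]
  rcases t.step j (t.shape_downs j.isLt.le) with ⟨e1, -⟩ | ⟨e1, -⟩
  · rw [e1, h] at e
    simp at e
  · exact e1

theorem cell_of_first (t : Tableau r n μ) (j : Fin n) (h : t.inSecond j = false) :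
    (t.cell j : ℕ × ℕ) = (0, j - t.downs j) := by
  have e : t.inSecond j = decide ((t.cell j : ℕ × ℕ).1 = 1) := by rw [inSecond, dif_pos j.isLt]
  rcases t.step j (t.shape_downs j.isLt.le) with ⟨e1, -⟩ | ⟨e1, -⟩
  · exact e1
  · rw [e1, h] at e
    simp at e

/-- The column of an entry is the number of earlier entries in its row, so the row word determines
the tableau. -/
theorem ext_inSecond {s t : Tableau r n μ} (h : ∀ j < n, s.inSecond j = t.inSecond j) : s = t := by
  apply Tableau.ext
  apply Equiv.ext
  intro j
  apply Subtype.ext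
  have hd : s.downs j = t.downs j := downs_congr fun k hk => h k (by omega)
  have hj := h j j.isLt
  cases hs : s.inSecond j
  · rw [cell_of_first s j hs, cell_of_first t j (hj ▸ hs), hd]
  · rw [cell_of_second s j hs, cell_of_second t j (hj ▸ hs), hd]

theorem downs_top (t : Tableau r n μ) : t.downs n = μ.rowLen 1 := by
  have h := (t.shape_downs le_rfl).2.2
  have key : ∀ y, y < μ.rowLen 1 ↔ y < t.downs n := by
    intro y
    rw [← YoungDiagram.mem_iff_lt_rowLen, ← YoungDiagram.mem_cells]
    constructor
    · intro hy
      have := (h (1, y)).1 ⟨t.cell.symm ⟨(1, y), hy⟩, Fin.isLt _, by simp⟩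
      simpa using this
    · intro hy
      obtain ⟨j, -, e⟩ := (h (1, y)).2 (Or.inr ⟨rfl, hy⟩)
      rw [← e]
      exact (t.cell j).2
  exact Nat.le_antisymm (Nat.le_of_not_lt fun hlt => absurd ((key _).2 hlt) (lt_irrefl _))
    (Nat.le_of_not_lt fun hlt => absurd ((key _).1 hlt) (lt_irrefl _))

theorem d_of_same (t : Tableau r n μ) (i : Fin (n - 1))
    (h : t.inSecond i = t.inSecond (i + 1)) : t.d i = -1 := by
  have hs := t.two_mul_downs_le (m := i) (by omega)
  have e := t.downs_succ i
  cases h1 : t.inSecond i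
  · have c1 := t.cell_of_first (lo i) h1
    have c2 := t.cell_of_first (hi i) (h ▸ h1)
    rw [d, c1, c2]
    simp only [lo, hi, e, h1]
    push_cast
    simp
    omega
  · have c1 := t.cell_of_second (lo i) h1
    have c2 := t.cell_of_second (hi i) (h ▸ h1)
    rw [d, c1, c2]
    simp only [lo, hi, e, h1]
    push_cast
    simp

/-- Here `i - 2 * t.downs i` is the height of the path before the peak. At a valley the same
expression appears with the opposite sign. -/
theorem d_of_peak (t : Tableau r n μ) (i : Fin (n - 1))
    (h1 : t.inSecond i = false) (h2 : t.inSecond (i + 1) = true) :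
    t.d i = i - 2 * t.downs i + 1 := by
  have hs := t.two_mul_downs_le (m := i) (by omega)
  have e := t.downs_succ i
  have c1 := t.cell_of_first (lo i) h1
  have c2 := t.cell_of_second (hi i) h2
  rw [d, c1, c2]
  simp only [lo, hi, e, h1]
  push_cast
  simp
  omega

theorem d_of_valley (t : Tableau r n μ) (i : Fin (n - 1))
    (h1 : t.inSecond i = true) (h2 : t.inSecond (i + 1) = false) :
    t.d i = 2 * t.downs i - i - 1 := by
  have hs := t.two_mul_downs_le (m := i) (by omega)
  have e := t.downs_succ i
  have c1 := t.cell_of_second (lo i) h1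
  have c2 := t.cell_of_first (hi i) h2
  rw [d, c1, c2]
  simp only [lo, hi, e, h1]
  push_cast
  simp
  omega

end Tableau

/-! ### Construction of tableaux from row words -/

theorem IsTwoRow.mem_cells_iff {r : ℕ} {μ : YoungDiagram} (h : IsTwoRow r μ) (c : ℕ × ℕ) :
    c ∈ μ.cells ↔ (c.1 = 0 ∧ c.2 < μ.rowLen 0) ∨ (c.1 = 1 ∧ c.2 < μ.rowLen 1) := by
  obtain ⟨x, y⟩ := c
  rw [YoungDiagram.mem_cells]
  constructor
  · intro hc
    have hx : x < 2 := by
      have h' : (x, 0) ∈ μ := μ.up_left_mem le_rfl (Nat.zero_le y) hc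
      rw [YoungDiagram.mem_iff_lt_colLen] at h'
      have := h.1
      omega
    rw [YoungDiagram.mem_iff_lt_rowLen] at hc
    interval_cases x
    · exact Or.inl ⟨rfl, hc⟩
    · exact Or.inr ⟨rfl, hc⟩
  · rintro (⟨hx, hy⟩ | ⟨hx, hy⟩) <;> simp only at hx hy <;> subst hx <;>
      exact YoungDiagram.mem_iff_lt_rowLen.2 hy

theorem IsTwoRow.card_eq {r : ℕ} {μ : YoungDiagram} (h : IsTwoRow r μ) :
    μ.card = μ.rowLen 0 + μ.rowLen 1 := by
  have e : μ.cells = μ.row 0 ∪ μ.row 1 := by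
    ext c
    rw [Finset.mem_union, YoungDiagram.mem_row_iff, YoungDiagram.mem_row_iff,
      ← YoungDiagram.mem_cells]
    have := (h.mem_cells_iff c).1
    constructor
    · intro hc
      rcases this hc with h | h
      · exact Or.inl ⟨hc, h.1⟩
      · exact Or.inr ⟨hc, h.1⟩
    · rintro (h | h) <;> exact h.1
  have hd : Disjoint (μ.row 0) (μ.row 1) := by
    rw [Finset.disjoint_left]
    intro c h0 h1
    have h0 := (YoungDiagram.mem_row_iff.1 h0).2
    have h1 := (YoungDiagram.mem_row_iff.1 h1).2
    omega
  rw [YoungDiagram.card, e, Finset.card_union_of_disjoint hd, ← YoungDiagram.rowLen_eq_card,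
    ← YoungDiagram.rowLen_eq_card]

/-- The cell of the entry `j` in the filling with row word `w`. -/
def wordCell (w : ℕ → Bool) (j : ℕ) : ℕ × ℕ :=
  if w j = true then (1, Nat.count (fun k => w k = true) j)
  else (0, Nat.count (fun k => w k = false) j)

theorem count_false_add_count_true (w : ℕ → Bool) (m : ℕ) :
    Nat.count (fun k => w k = false) m + Nat.count (fun k => w k = true) m = m := by
  induction m with
  | zero => simp
  | succ m ih =>
    rw [Nat.count_succ, Nat.count_succ]
    cases w m <;> simp <;> omega

theorem wordCell_injective (w : ℕ → Bool) : Function.Injective (wordCell w) := by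
  intro j k h
  rw [wordCell, wordCell] at h
  split_ifs at h with h1 h2 h2
  · exact Nat.count_injective (p := fun k => w k = true) h1 h2 (Prod.mk.inj h).2
  · simp at h
  · simp at h
  · exact Nat.count_injective (p := fun k => w k = false) (by simpa using h1) (by simpa using h2)
      (Prod.mk.inj h).2

theorem exists_wordCell_iff (w : ℕ → Bool) (m : ℕ) (c : ℕ × ℕ) :
    (∃ j < m, wordCell w j = c) ↔ (c.1 = 0 ∧ c.2 < Nat.count (fun k => w k = false) m) ∨
      (c.1 = 1 ∧ c.2 < Nat.count (fun k => w k = true) m) := by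
  obtain ⟨x, y⟩ := c
  induction m with
  | zero => simp
  | succ m ih =>
    have : (∃ j < m + 1, wordCell w j = (x, y)) ↔
        (∃ j < m, wordCell w j = (x, y)) ∨ wordCell w m = (x, y) := by
      constructor
      · rintro ⟨j, hj, e⟩
        rcases Nat.lt_succ_iff_lt_or_eq.1 hj with hj | rfl
        · exact Or.inl ⟨j, hj, e⟩
        · exact Or.inr e
      · rintro (⟨j, hj, e⟩ | e)
        · exact ⟨j, by omega, e⟩
        · exact ⟨m, by omega, e⟩
    rw [this, ih, wordCell, Nat.count_succ, Nat.count_succ]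
    cases w m <;> simp only [Bool.false_eq_true, if_false, if_true, reduceCtorEq,
      Prod.mk.injEq] <;> omega

/-- A row word whose partial counts stay within the bounds is the row word of a tableau. -/
theorem Tableau.exists_of_word {r n : ℕ} {μ : YoungDiagram} (hμ : IsTwoRow r μ) (hn : μ.card = n)
    (w : ℕ → Bool)
    (hw : ∀ m ≤ n, 2 * Nat.count (fun k => w k = true) m ≤ m ∧
      m + 2 ≤ 2 * Nat.count (fun k => w k = true) m + r)
    (htop : Nat.count (fun k => w k = true) n = μ.rowLen 1) :
    ∃ t : Tableau r n μ, ∀ j < n, t.inSecond j = w j := by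
  have hc := hμ.card_eq
  have hsum := count_false_add_count_true w
  have hmem : ∀ j : Fin n, wordCell w j ∈ μ.cells := by
    intro j
    rw [hμ.mem_cells_iff]
    have := (exists_wordCell_iff w n (wordCell w j)).1 ⟨j, j.isLt, rfl⟩
    have h2 := hsum n
    rw [htop] at this h2
    rwa [show Nat.count (fun k => w k = false) n = μ.rowLen 0 by omega] at this
  let f : Fin n → μ.cells := fun j => ⟨wordCell w j, hmem j⟩
  have hf : Function.Bijective f := by
    rw [Fintype.bijective_iff_injective_and_card]
    refine ⟨fun j k h => Fin.ext (wordCell_injective w (congrArg Subtype.val h)), ?_⟩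
    rw [Fintype.card_fin, Fintype.card_coe]
    exact hn.symm
  have hsh : ∀ m ≤ n, ∃ a b, Shape r (Equiv.ofBijective f hf) m a b := by
    intro m hm
    refine ⟨Nat.count (fun k => w k = false) m, Nat.count (fun k => w k = true) m, ?_, ?_, ?_⟩
    · have := hsum m; have := hw m hm; omega
    · have := hsum m; have := hw m hm; omega
    · intro c
      rw [← exists_wordCell_iff]
      constructor
      · rintro ⟨j, hj, e⟩
        exact ⟨j, hj, e⟩
      · rintro ⟨j, hj, e⟩
        exact ⟨⟨j, by omega⟩, hj, e⟩
  refine ⟨ofShapes _ hsh, fun j hj => ?_⟩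
  have e : ((ofShapes _ hsh : Tableau r n μ).cell ⟨j, hj⟩ : ℕ × ℕ) = wordCell w j := rfl
  rw [inSecond, dif_pos hj, e, wordCell]
  cases w j <;> simp

/-- Counts for the row word that alternates `b` times and then fills up the first row. -/
theorem count_alternating (b m : ℕ) :
    Nat.count (fun k => (decide (k % 2 = 1 ∧ k < 2 * b)) = true) m = min (m / 2) b := by
  induction m with
  | zero => simp
  | succ m ih =>
    rw [Nat.count_succ, ih]
    split_ifs with h <;> simp only [decide_eq_true_eq] at h <;> omega

/-- The path oscillates between heights `0` and `1` and then climbs to `λ₁ - λ₂ ≤ r - 2`; height `1`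
is allowed because `r ≥ 3`. -/
theorem Tableau.exists_alternating {r n : ℕ} {μ : YoungDiagram} (hr : 3 ≤ r) (hμ : IsTwoRow r μ)
    (hn : μ.card = n) : ∃ t : Tableau r n μ, ∀ j < n,
      t.inSecond j = decide (j % 2 = 1 ∧ j < 2 * μ.rowLen 1) := by
  have hc := hμ.card_eq
  have h2 := hμ.2
  have h3 := μ.rowLen_anti 0 1 (by omega)
  apply exists_of_word hμ hn
  · intro m hm
    rw [count_alternating]
    omega
  · rw [count_alternating]
    omega

theorem Tableau.nonempty {r n : ℕ} {μ : YoungDiagram} (hr : 3 ≤ r) (hμ : IsTwoRow r μ)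
    (hn : μ.card = n) : Nonempty (Tableau r n μ) :=
  let ⟨t, _⟩ := exists_alternating hr hμ hn
  ⟨t⟩

/-- The alternating path starts with a peak from height `0`. There `α = 1`, which will show that the
first projector is nonzero. -/
theorem Tableau.exists_d_eq_one {r n : ℕ} {μ : YoungDiagram} (hr : 3 ≤ r) (hμ : IsTwoRow r μ)
    (hn : μ.card = n) (h1 : 0 < μ.rowLen 1) (i : Fin (n - 1)) (hi : i.val = 0) :
    ∃ t : Tableau r n μ, t.d i = 1 := by
  obtain ⟨t, ht⟩ := exists_alternating hr hμ hn
  refine ⟨t, ?_⟩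
  rw [t.d_of_peak i, hi, downs_zero]
  · simp
  · rw [ht _ (by omega), hi]
    simp
  · rw [ht _ (by omega), hi]
    simp
    omega

/-! ### Irreducibility -/

theorem q_isPrimitiveRoot {r : ℕ} (hr : 3 ≤ r) : IsPrimitiveRoot (q r) r :=
  Complex.isPrimitiveRoot_exp r (by omega)

theorem q_ne_zero (r : ℕ) : q r ≠ 0 := Complex.exp_ne_zero _

theorem q_zpow_ne_one {r : ℕ} (hr : 3 ≤ r) {k : ℤ} (h : k ≠ 0) (h0 : -(r : ℤ) < k) (h1 : k < r) :
    q r ^ k ≠ 1 := by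
  rw [Ne, (q_isPrimitiveRoot hr).zpow_eq_one_iff_dvd]
  intro hd
  exact h (Int.eq_zero_of_abs_lt_dvd hd (abs_lt.2 ⟨h0, h1⟩))

theorem one_add_q_ne_zero {r : ℕ} (hr : 3 ≤ r) : 1 + q r ≠ 0 := by
  intro h
  have h1 : q r = -1 := by linear_combination h
  apply q_zpow_ne_one hr (k := 2) (by omega) (by omega) (by omega)
  rw [h1]
  norm_num

/-- `q - (1 + q) α` in terms of `q^d`. -/
theorem q_sub_alphaOf {r : ℕ} (hr : 3 ≤ r) {x : ℤ} (hx : x ≠ 0) (h0 : -(r : ℤ) < x)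
    (h1 : x < r) : (q r - (1 + q r) * alphaOf r x) * (q r ^ x - 1) = 1 - q r := by
  have hq : q r = Complex.exp (Real.pi * Complex.I / r) ^ 2 := by
    rw [q, ← Complex.exp_nat_mul]
    congr 1
    push_cast
    ring
  have hne := qInt_ne_zero hr hx h0 h1
  have hp1 := one_add_q_ne_zero hr
  have hd := sub_ne_zero.2 (q_zpow_ne_one hr hx h0 h1)
  have hd1 := sub_ne_zero.2 (q_zpow_ne_one hr (k := 1) (by omega) (by omega) (by omega))
  rw [zpow_one] at hd1
  have hqx : q r ^ x = (Complex.exp (Real.pi * Complex.I / r) ^ x) ^ 2 := by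
    rw [hq, ← zpow_natCast, ← zpow_natCast, ← zpow_mul, ← zpow_mul,
      mul_comm x]
  rw [alphaOf]
  push_cast
  rw [qInt_eq, qInt_eq, qInt_eq]
  have hz := Complex.exp_ne_zero (Real.pi * Complex.I / r)
  rw [hqx] at hd ⊢
  rw [hq] at hp1 hd1 ⊢
  -- With `z = q^{1/2}` and `y = z ^ x` the claim is a rational identity in `z` and `y`; the facts
  -- about `q` and `q ^ x` say that its denominators do not vanish.
  generalize Complex.exp (Real.pi * Complex.I / r) = z at *
  have hzx := zpow_ne_zero x hz
  rw [zpow_neg, zpow_neg, zpow_neg, zpow_add₀ hz, zpow_one]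
  generalize z ^ x = y at *
  have hyy : y - y⁻¹ ≠ 0 := by
    intro h
    apply hd
    field_simp at h
    linear_combination h
  have hzz : z - z⁻¹ ≠ 0 := by
    intro h
    apply hd1
    field_simp at h
    linear_combination h
  have hz2 : z ^ (2 : ℤ) - (z ^ (2 : ℤ))⁻¹ = (z + z⁻¹) * (z - z⁻¹) := by
    rw [show (2 : ℤ) = ((2 : ℕ) : ℤ) from rfl, zpow_natCast]
    field_simp
    ring
  have hzp : z + z⁻¹ ≠ 0 := by
    intro h
    apply hp1
    field_simp at h
    linear_combination h
  rw [hz2]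
  have e1 : z + z⁻¹ = (1 + z ^ 2) / z := by
    field_simp
    ring
  have e2 : y - y⁻¹ = (y ^ 2 - 1) / y := by field_simp
  have e3 : z - z⁻¹ = (z ^ 2 - 1) / z := by field_simp
  rw [e1, e2, e3]
  field_simp
  ring

/-! ### Contents and admissible exchanges -/

namespace Tableau

variable {r n : ℕ} {μ : YoungDiagram}

/-- The content (column minus row) of the cell of an entry. -/
def content (t : Tableau r n μ) (k : Fin n) : ℤ :=
  ((t.cell k : ℕ × ℕ).2 : ℤ) - ((t.cell k : ℕ × ℕ).1 : ℤ)

theorem d_eq_content (t : Tableau r n μ) (i : Fin (n - 1)) :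
    t.d i = t.content (lo i) - t.content (hi i) := by
  rw [d, content, content]
  ring

theorem content_zero (t : Tableau r n μ) (k : Fin n) (hk : k.val = 0) : t.content k = 0 := by
  cases h : t.inSecond k
  · rw [content, t.cell_of_first k h, hk, downs_zero]
    simp
  · have h1 := t.two_mul_downs_le (m := k + 1) k.isLt
    rw [downs_succ, h, hk, downs_zero] at h1
    simp at h1

/-- The contents, read in the exponent of `q`, separate the tableaux. -/
theorem exists_q_content_ne (hr : 3 ≤ r) {s t : Tableau r n μ} (h : s ≠ t) :
    ∃ k : Fin n, q r ^ s.content k ≠ q r ^ t.content k := by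
  have hex : ∃ j, j < n ∧ s.inSecond j ≠ t.inSecond j := by
    by_contra hc
    push Not at hc
    exact h (ext_inSecond hc)
  classical
  -- Take the first entry `j` whose rows differ: both tableaux then add a box to the same shape.
  obtain ⟨hj, hne⟩ := Nat.find_spec hex
  have hmin := fun k => Nat.find_min hex (m := k)
  generalize Nat.find hex = j at *
  have hd : s.downs j = t.downs j := by
    apply downs_congr
    intro k hk
    have := hmin k hk
    by_contra hc
    exact this ⟨by omega, hc⟩
  refine ⟨⟨j, hj⟩, fun he => ?_⟩
  have key : ∀ u v : Tableau r n μ, u.downs j = v.downs j → u.inSecond j = true →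
      v.inSecond j = false → q r ^ u.content ⟨j, hj⟩ ≠ q r ^ v.content ⟨j, hj⟩ := by
    intro u v huv hu hv he
    have b1 := u.two_mul_downs_le (m := j) (by omega)
    have b2 := u.le_two_mul_downs (m := j) (by omega)
    rw [content, content, u.cell_of_second ⟨j, hj⟩ hu, v.cell_of_first ⟨j, hj⟩ hv, ← huv] at he
    simp only at he
    -- The two boxes that can be added have contents `j - downs` and `downs - 1`. Their difference
    -- is the height plus one, which lies in `[1, r - 1]`.
    apply q_zpow_ne_one hr (k := ((j - u.downs j : ℕ) : ℤ) - (u.downs j - 1)) (by omega)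
      (by omega) (by omega)
    rw [zpow_sub₀ (q_ne_zero r), div_eq_one_iff_eq (zpow_ne_zero _ (q_ne_zero r))]
    simpa using he.symm
  cases hs : s.inSecond j <;> cases ht : t.inSecond j
  · exact hne (by rw [hs, ht])
  · exact key t s hd.symm ht hs he.symm
  · exact key s t hd hs ht he
  · exact hne (by rw [hs, ht])

theorem content_of_swapped {s t : Tableau r n μ} {i : Fin (n - 1)} (h : s.cell = t.swapped i) :
    s.content (lo i) = t.content (hi i) ∧ s.content (hi i) = t.content (lo i) := by
  have h1 : s.cell (lo i) = t.cell (hi i) := by simp [h, swapped]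
  have h2 : s.cell (hi i) = t.cell (lo i) := by simp [h, swapped]
  rw [content, content, content, content, h1, h2]
  exact ⟨rfl, rfl⟩

theorem inSecond_of_swapped {s t : Tableau r n μ} {i : Fin (n - 1)} (h : s.cell = t.swapped i) :
    s.inSecond i = t.inSecond (i + 1) := by
  have h1 : s.cell (lo i) = t.cell (hi i) := by simp [h, swapped]
  rw [inSecond, inSecond, dif_pos (show i.val < n from (lo i).isLt),
    dif_pos (show i.val + 1 < n from (hi i).isLt)]
  change decide ((s.cell (lo i) : ℕ × ℕ).1 = 1) = decide ((t.cell (hi i) : ℕ × ℕ).1 = 1)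
  rw [h1]

/-- Let `h` be the height before the peak. The valley of `s` reaches `h - 1 ≥ 0`, the peak of `t`
reaches `h + 1 ≤ r - 2`, and `d = h + 1`. -/
theorem d_bounds_of_peak {s t : Tableau r n μ} {i : Fin (n - 1)} (h : s.cell = t.swapped i)
    (h1 : t.inSecond i = false) (h2 : t.inSecond (i + 1) = true) :
    1 < t.d i ∧ t.d i < r - 1 := by
  have e1 := inSecond_of_swapped h
  have e2 := inSecond_of_swapped (swapped_symm h)
  rw [h2] at e1
  rw [h1] at e2
  have hd := d_of_swapped h
  have b1 := s.two_mul_downs_le (m := i + 1) (by omega)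
  have b2 := t.le_two_mul_downs (m := i + 1) (by omega)
  rw [downs_succ, e1, if_pos rfl] at b1
  rw [downs_succ, h1] at b2
  rw [s.d_of_valley i e1 e2.symm] at hd
  rw [t.d_of_peak i h1 h2] at hd ⊢
  simp at b2
  omega

/-- At a peak `β² = α(d) α(-d)` has numerators `[d + 1]` and `[1 - d]`, nonzero because `1 < d < r -
1`. A valley reduces to a peak since `β` is unchanged by the exchange. Two entries in one row cannot
be exchanged: `d` would be `-1` on both sides and also change sign. -/
theorem beta_ne_zero (hr : 3 ≤ r) {s t : Tableau r n μ} {i : Fin (n - 1)}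
    (h : s.cell = t.swapped i) : t.beta i ≠ 0 := by
  have key : ∀ {u v : Tableau r n μ}, v.cell = u.swapped i → u.inSecond i = false →
      u.inSecond (i + 1) = true → u.beta i ≠ 0 := by
    intro u v huv h1 h2
    have hd := d_bounds_of_peak huv h1 h2
    intro hb
    have hsq := beta_sq hr u i
    rw [hb, mul_zero, alpha_eq, ← alphaOf_neg hr (qInt_d hr u i)] at hsq
    have h2 := two_ne hr
    have hq := qInt_d hr u i
    have n1 := qInt_ne_zero hr (k := u.d i + 1) (by omega) (by omega) (by omega)
    have n2 := qInt_ne_zero hr (k := -u.d i + 1) (by omega) (by omega) (by omega)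
    have hq' : qInt r (-u.d i) ≠ 0 := by rw [qInt_neg]; exact neg_ne_zero.2 hq
    exact mul_ne_zero (div_ne_zero n1 (mul_ne_zero h2 hq)) (div_ne_zero n2 (mul_ne_zero h2 hq'))
      hsq.symm
  have e1 := inSecond_of_swapped h
  have e2 := inSecond_of_swapped (swapped_symm h)
  have hd := d_of_swapped h
  cases h1 : t.inSecond i <;> cases h2 : t.inSecond (i + 1)
  · rw [t.d_of_same i (by rw [h1, h2]), s.d_of_same i (by rw [e1, ← e2, h1, h2])] at hd
    omega
  · exact key h h1 h2
  · rw [← beta_of_swapped hr h]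
    exact key (swapped_symm h) (e1.trans h2) (e2.symm.trans h1)
  · rw [t.d_of_same i (by rw [h1, h2]), s.d_of_same i (by rw [e1, ← e2, h1, h2])] at hd
    omega

theorem G_G (i : Fin (n - 1)) {s t : Tableau r n μ} (h : s.cell = t.swapped i) : G i s = t := by
  apply Tableau.ext
  rw [G_spec i s ⟨t, swapped_symm h⟩, ← swapped_symm h]

/-! #### Connectedness under exchanges -/

/-- A statistic that decreases when a peak is exchanged for a valley. -/
def energy (t : Tableau r n μ) : ℕ := ∑ k : Fin n, k.val * (t.cell k : ℕ × ℕ).1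

/-- The energy is the sum of the entries in the second row, and the exchange replaces `i + 1` by `i`
there. -/
theorem energy_lt {s t : Tableau r n μ} {i : Fin (n - 1)} (h : s.cell = t.swapped i)
    (h1 : t.inSecond i = false) (h2 : t.inSecond (i + 1) = true) : s.energy < t.energy := by
  have e1 : (t.cell (lo i) : ℕ × ℕ).1 = 0 := by rw [t.cell_of_first (lo i) h1]
  have e2 : (t.cell (hi i) : ℕ × ℕ).1 = 1 := by rw [t.cell_of_second (hi i) h2]
  have hs : s.energy =
      ∑ k : Fin n, (Equiv.swap (lo i) (hi i) k).val * (t.cell k : ℕ × ℕ).1 := by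
    rw [energy, ← Equiv.sum_comp (Equiv.swap (lo i) (hi i))]
    refine Finset.sum_congr rfl fun k _ => ?_
    simp [h, swapped]
  rw [hs, energy]
  refine Finset.sum_lt_sum (fun k _ => ?_) ⟨hi i, Finset.mem_univ _, ?_⟩
  · rw [Equiv.swap_apply_def]
    split_ifs with h3 h4
    · rw [h3, e1, mul_zero]
      exact Nat.zero_le _
    · rw [h4]
      exact Nat.mul_le_mul_right _ (by simp [lo, hi])
    · exact le_rfl
  · rw [Equiv.swap_apply_right, e2]
    simp [lo, hi]

/-- A down-step starts at height at most `1`: after an up-step, `d ≤ 1` forces that up-step to start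
at height `0`; after a down-step the bound is inherited. -/
theorem descent_of_no_peak (t : Tableau r n μ) (ht : ∀ i : Fin (n - 1), t.d i ≤ 1) (m : ℕ)
    (hm : m < n) (h : t.inSecond m = true) : m ≤ 2 * t.downs m + 1 := by
  induction m with
  | zero => omega
  | succ m ih =>
    have hd := t.downs_succ m
    cases h1 : t.inSecond m
    · have h2 := ht ⟨m, by omega⟩
      rw [t.d_of_peak ⟨m, by omega⟩ h1 h] at h2
      rw [h1] at hd
      simp at hd h2
      omega
    · have := ih (by omega) h1
      rw [h1, if_pos rfl] at hd
      omega

/-- There is only one tableau without high peaks. -/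
theorem eq_of_no_peak {s t : Tableau r n μ} (hs : ∀ i : Fin (n - 1), s.d i ≤ 1)
    (ht : ∀ i : Fin (n - 1), t.d i ≤ 1) : s = t := by
  -- A step is a down-step exactly when it ends at height `0`, so the height after a step determines
  -- the step.
  have hrow : ∀ u : Tableau r n μ, (∀ i : Fin (n - 1), u.d i ≤ 1) → ∀ m < n,
      (u.inSecond m = true ↔ m + 1 = 2 * u.downs (m + 1)) := by
    intro u hu m hm
    have hd := u.downs_succ m
    have b1 := u.two_mul_downs_le (m := m) (by omega)
    have b2 := u.two_mul_downs_le (m := m + 1) (by omega)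
    constructor
    · intro h
      have := u.descent_of_no_peak hu m hm h
      rw [h, if_pos rfl] at hd
      omega
    · intro h
      by_contra hc
      rw [if_neg hc] at hd
      omega
  -- The words are reconstructed backwards from their common final count `μ.rowLen 1`.
  have hall : ∀ k ≤ n, s.downs (n - k) = t.downs (n - k) ∧
      ∀ m < n, n - k ≤ m → s.inSecond m = t.inSecond m := by
    intro k
    induction k with
    | zero =>
      intro _
      refine ⟨by rw [Nat.sub_zero, downs_top, downs_top], fun m _ _ => by omega⟩
    | succ k ih =>
      intro hk
      obtain ⟨i1, i2⟩ := ih (by omega)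
      have e : n - k = n - (k + 1) + 1 := by omega
      rw [e] at i1
      have hrow' : s.inSecond (n - (k + 1)) = t.inSecond (n - (k + 1)) := by
        rw [Bool.eq_iff_iff, hrow s hs _ (by omega), hrow t ht _ (by omega), i1]
      rw [downs_succ, downs_succ, hrow'] at i1
      refine ⟨by omega, fun m hm hkm => ?_⟩
      rcases Nat.eq_or_lt_of_le hkm with rfl | hlt
      · exact hrow'
      · exact i2 m hm (by omega)
  exact ext_inSecond fun m hm => (hall n le_rfl).2 m hm (by omega)

/-- A set of tableaux that is stable under exchanges is empty or everything. -/
theorem forall_mem_of_swapped {S : Set (Tableau r n μ)}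
    (hS : ∀ (i : Fin (n - 1)) (s t : Tableau r n μ), s.cell = t.swapped i → t ∈ S → s ∈ S)
    {t : Tableau r n μ} (ht : t ∈ S) (s : Tableau r n μ) : s ∈ S := by
  -- Every `d > 1` comes from an exchangeable peak. Lowering such peaks decreases the energy, so
  -- every tableau is linked to the unique one without them.
  have key : ∀ (N : ℕ) (u : Tableau r n μ), u.energy = N →
      ∃ v : Tableau r n μ, (∀ i : Fin (n - 1), v.d i ≤ 1) ∧ (v ∈ S ↔ u ∈ S) := by
    intro N
    induction N using Nat.strong_induction_on with
    | _ N ih =>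
      intro u hu
      by_cases h : ∀ i : Fin (n - 1), u.d i ≤ 1
      · exact ⟨u, h, Iff.rfl⟩
      push Not at h
      obtain ⟨i, hi⟩ := h
      obtain ⟨v, hv⟩ := u.exists_swap i (by omega) (by omega) (by have := u.d_bounds i; omega)
      have hpeak : u.inSecond i = false ∧ u.inSecond (i + 1) = true := by
        cases h1 : u.inSecond i <;> cases h2 : u.inSecond (i + 1)
        · rw [u.d_of_same i (by rw [h1, h2])] at hi
          omega
        · exact ⟨rfl, rfl⟩
        · have b1 := u.two_mul_downs_le (m := i) (by omega)
          rw [u.d_of_valley i h1 h2] at hi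
          omega
        · rw [u.d_of_same i (by rw [h1, h2])] at hi
          omega
      obtain ⟨x, hx, hxS⟩ := ih v.energy (hu ▸ energy_lt hv hpeak.1 hpeak.2) v rfl
      exact ⟨x, hx, hxS.trans ⟨hS i _ _ (swapped_symm hv), hS i _ _ hv⟩⟩
  obtain ⟨x, hx, hxt⟩ := key _ t rfl
  obtain ⟨y, hy, hys⟩ := key _ s rfl
  rw [eq_of_no_peak hx hy] at hxt
  exact hys.1 (hxt.2 ht)

end Tableau

/-! ### Invariant subspaces and Jucys-Murphy operators -/

section irreducible

variable {r n : ℕ} {μ : YoungDiagram}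

open Tableau

theorem sigmaMatrix_mulVec (i : Fin (n - 1)) (f : Tableau r n μ → ℂ) :
    (sigmaMatrix r n μ i).mulVec f = q r • f - (1 + q r) • (projector r n μ i).mulVec f := by
  rw [sigmaMatrix, Matrix.sub_mulVec, Matrix.smul_mulVec, Matrix.smul_mulVec, Matrix.one_mulVec]

/-- Conjugation by the generators moves the diagonal operators `q^content` along. -/
theorem sigmaMatrix_content (hr : 3 ≤ r) (i : Fin (n - 1)) (f : Tableau r n μ → ℂ) :
    (sigmaMatrix r n μ i).mulVec (fun t => q r ^ t.content (lo i) *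
      (sigmaMatrix r n μ i).mulVec f t) = q r • fun t => q r ^ t.content (hi i) * f t := by
  ext t
  simp only [sigmaMatrix_mulVec, Pi.sub_apply, Pi.smul_apply, smul_eq_mul, projector_mulVec hr]
  have hd := t.d_bounds i
  have hkey := q_sub_alphaOf hr hd.1 hd.2.1 hd.2.2
  rw [← alpha_eq, d_eq_content, zpow_sub₀ (q_ne_zero r)] at hkey
  have hy := zpow_ne_zero (t.content (hi i)) (q_ne_zero r)
  have hbb : (t.beta i : ℂ) * t.beta i = t.alpha i * (1 - t.alpha i) := by
    exact_mod_cast beta_sq hr t i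
  have hxy : (q r - (1 + q r) * t.alpha i) *
      (q r ^ t.content (lo i) - q r ^ t.content (hi i)) = (1 - q r) * q r ^ t.content (hi i) := by
    rw [← hkey]
    field_simp
  -- On the span of `v_t` and its exchange this is a `2 × 2` identity, in which the exchange swaps
  -- the two contents; without an exchange `β = 0` and it is scalar.
  by_cases h : ∃ s : Tableau r n μ, s.cell = t.swapped i
  · have hG := G_spec i t h
    rw [G_G i hG, alpha_of_swapped hr hG, beta_of_swapped hr hG, (content_of_swapped hG).1]
    push_cast
    generalize q r ^ t.content (lo i) = x at *
    generalize q r ^ t.content (hi i) = y at *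
    generalize (t.alpha i : ℂ) = α at *
    generalize (t.beta i : ℂ) = β at *
    linear_combination ((q r - (1 + q r) * α) * f t - (1 + q r) * β * f (G i t)) * hxy +
      (1 + q r) ^ 2 * y * f t * hbb
  · have hb : t.beta i = 0 := by rcases extreme hr t i h with h | h <;> exact h.2.2
    rw [hb] at hbb ⊢
    push_cast at hbb ⊢
    linear_combination (q r - (1 + q r) * t.alpha i) * f t * hxy +
      (1 + q r) ^ 2 * q r ^ t.content (hi i) * f t * hbb

variable {W : Submodule ℂ (Tableau r n μ → ℂ)}

/-- Induction along `σ_k J_k σ_k = q J_{k+1}`, starting from `J_0 = 1` because the entry `0` has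
content `0`. -/
theorem content_smul_mem (hr : 3 ≤ r)
    (hW : ∀ (i : Fin (n - 1)), ∀ f ∈ W, (sigmaMatrix r n μ i).mulVec f ∈ W) (k : Fin n) :
    ∀ f ∈ W, (fun t => q r ^ t.content k * f t) ∈ W := by
  obtain ⟨k, hk⟩ := k
  induction k with
  | zero =>
    intro f hf
    have : (fun t : Tableau r n μ => q r ^ t.content ⟨0, hk⟩ * f t) = f := by
      ext t
      rw [t.content_zero _ rfl, zpow_zero, one_mul]
    rwa [this]
  | succ k ih =>
    intro f hf
    have h := sigmaMatrix_content hr ⟨k, by omega⟩ f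
    have h1 := hW ⟨k, by omega⟩ _ (ih (by omega) _ (hW ⟨k, by omega⟩ f hf))
    have h2 : q r • (fun t : Tableau r n μ => q r ^ t.content ⟨k + 1, hk⟩ * f t) ∈ W := by
      rw [← show hi (⟨k, by omega⟩ : Fin (n - 1)) = ⟨k + 1, hk⟩ from rfl, ← h]
      exact h1
    exact (Submodule.smul_mem_iff W (q_ne_zero r)).1 h2

/-- Lagrange interpolation: for each `s ≠ t` choose `k` with different eigenvalues of `J_k` and
apply `J_k - q ^ s.content k`, normalised to keep the coefficient at `t` equal to `1`; this removes
the coefficient at `s`. -/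
theorem single_mem (hr : 3 ≤ r)
    (hW : ∀ (i : Fin (n - 1)), ∀ f ∈ W, (sigmaMatrix r n μ i).mulVec f ∈ W)
    {f : Tableau r n μ → ℂ} (hf : f ∈ W) (t : Tableau r n μ) (ht : f t ≠ 0) :
    Pi.single t 1 ∈ W := by
  have key : ∀ S : Finset (Tableau r n μ), t ∉ S → ∃ g ∈ W, g t = 1 ∧ ∀ s ∈ S, g s = 0 := by
    intro S
    induction S using Finset.induction_on with
    | empty =>
      intro _
      exact ⟨(f t)⁻¹ • f, W.smul_mem _ hf, by simp [ht], by simp⟩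
    | insert s S _ ih =>
      intro h
      rw [Finset.mem_insert, not_or] at h
      obtain ⟨g, hg, g1, g0⟩ := ih h.2
      obtain ⟨k, hk⟩ := exists_q_content_ne hr h.1
      refine ⟨(q r ^ t.content k - q r ^ s.content k)⁻¹ •
        ((fun u => q r ^ u.content k * g u) - q r ^ s.content k • g),
        W.smul_mem _ (W.sub_mem (content_smul_mem hr hW k g hg) (W.smul_mem _ hg)), ?_, ?_⟩
      · simp [g1, sub_ne_zero.2 hk]
      · intro u hu
        rcases Finset.mem_insert.1 hu with rfl | hu
        · simp
        · simp [g0 u hu]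
  obtain ⟨g, hg, g1, g0⟩ := key (Finset.univ.erase t) (by simp)
  convert hg
  ext s
  by_cases h : s = t
  · rw [h, g1, Pi.single_eq_same]
  · rw [Pi.single_eq_of_ne h, g0 s (by simp [h])]

/-- Once `v_t` lies in `W`, the vector `σ_i v_t` has coefficient `-(1 + q) β ≠ 0` at the exchanged
tableau, so the tableaux with `v_s ∈ W` are stable under exchanges. -/
theorem eq_bot_or_eq_top_of_invariant (hr : 3 ≤ r)
    (hW : ∀ (i : Fin (n - 1)), ∀ f ∈ W, (sigmaMatrix r n μ i).mulVec f ∈ W) :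
    W = ⊥ ∨ W = ⊤ := by
  rw [or_iff_not_imp_left]
  intro hne
  obtain ⟨f, hf, f0⟩ := W.ne_bot_iff.1 hne
  obtain ⟨t, ht⟩ := Function.ne_iff.1 f0
  have hS : ∀ s, s ∈ {s : Tableau r n μ | (Pi.single s 1 : Tableau r n μ → ℂ) ∈ W} := by
    refine forall_mem_of_swapped ?_ (single_mem hr hW hf t ht)
    intro i s t hst (h : Pi.single t 1 ∈ W)
    refine single_mem hr hW (hW i _ h) s ?_
    have hne : s ≠ t := by
      rintro rfl
      exact not_swapped_self s i hst
    rw [sigmaMatrix_mulVec, Pi.sub_apply, Pi.smul_apply, Pi.smul_apply, projector_mulVec hr,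
      G_G i hst, Pi.single_eq_same, Pi.single_eq_of_ne hne]
    have := beta_ne_zero hr (swapped_symm hst)
    simp [this, one_add_q_ne_zero hr]
  rw [eq_top_iff]
  intro g _
  rw [pi_eq_sum_univ' g]
  refine W.sum_mem fun s _ => W.smul_mem _ ?_
  exact hS s

theorem sectorRep_σ (hr : 3 ≤ r) (i : Fin (n - 1)) (f : Tableau r n μ → ℂ) :
    sectorRep r n hr μ (BraidGroup.σ i) f = (sigmaMatrix r n μ i).mulVec f := by
  change Matrix.toLinAlgEquiv' ((sector r n hr μ (BraidGroup.σ i) :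
    Matrix.unitaryGroup (Tableau r n μ) ℂ) : Matrix (Tableau r n μ) (Tableau r n μ) ℂ) f = _
  rw [sector, BraidGroup.σ, PresentedGroup.toGroup.of, Matrix.toLinAlgEquiv'_apply]
  rfl

theorem sectorRep_isIrreducible (hr : 3 ≤ r) (hμ : IsTwoRow r μ) (hn : μ.card = n) :
    (sectorRep r n hr μ).IsIrreducible := by
  have : Nonempty (Tableau r n μ) := Tableau.nonempty hr hμ hn
  have hnt : Nontrivial (Subrepresentation (sectorRep r n hr μ)) := by
    refine ⟨⊥, ⊤, fun h => ?_⟩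
    have h' := congrArg Subrepresentation.toSubmodule h
    exact bot_ne_top (α := Submodule ℂ (Tableau r n μ → ℂ)) h'
  refine { eq_bot_or_eq_top := fun U => ?_ }
  have := eq_bot_or_eq_top_of_invariant (W := U.toSubmodule) hr fun i f hf => by
    rw [← sectorRep_σ hr]
    exact U.apply_mem_toSubmodule _ hf
  rcases this with h | h
  · exact Or.inl (Subrepresentation.toSubmodule_injective h)
  · exact Or.inr (Subrepresentation.toSubmodule_injective h)

end irreducible

/-! ### Infinite image -/

/-- Galois conjugation of a polynomial relation between roots of unity. -/
theorem aeval_pow_eq_zero_of_coprime {M k : ℕ} (hM : 0 < M) {ζ : ℂ} (hζ : IsPrimitiveRoot ζ M)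
    (hk : k.Coprime M) {P : Polynomial ℤ} (hP : Polynomial.aeval ζ P = 0) :
    Polynomial.aeval (ζ ^ k) P = 0 := by
  have h := minpoly.isIntegrallyClosed_dvd (hζ.isIntegral hM) hP
  rw [hζ.minpoly_eq_pow_coprime hk] at h
  exact Polynomial.aeval_eq_zero_of_dvd_aeval_eq_zero h (minpoly.aeval _ _)

/-- Units modulo `r` lift to units modulo `M`; equivalently, `q ↦ q ^ k` extends to a larger
cyclotomic field. -/
theorem exists_coprime_modEq {r M k : ℕ} (hM : 0 < M) (hd : r ∣ M) (hk : k.Coprime r) :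
    ∃ l : ℕ, l.Coprime M ∧ l ≡ k [MOD r] := by
  have : NeZero M := ⟨hM.ne'⟩
  obtain ⟨v, hv⟩ := ZMod.unitsMap_surjective hd (ZMod.unitOfCoprime k hk)
  refine ⟨(v : ZMod M).val, ZMod.val_coe_unit_coprime v, ?_⟩
  rw [← ZMod.natCast_eq_natCast_iff]
  have h := congrArg (fun u : (ZMod r)ˣ => (u : ZMod r)) hv
  simp only [ZMod.unitsMap_val, ZMod.coe_unitOfCoprime] at h
  rw [← h, ZMod.natCast_val]

/-- Take `j = 1` for odd `r`, `j = 2` for `4 ∣ r`, and `j = 4` for `r ≡ 2` modulo `4`. The last case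
needs `12 < r`, which is where `6` and `10` drop out. The bound `3 * j < r` puts `q ^ k` within
angle `π / 3` of `-1`. -/
theorem exists_coprime_near_half {r : ℕ} (hr : 5 ≤ r) (h6 : r ≠ 6) (h10 : r ≠ 10) :
    ∃ k j : ℕ, 2 * k + j = r ∧ 0 < j ∧ 3 * j < r ∧ k.Coprime r := by
  have key : ∀ k j : ℕ, 2 * k + j = r → k.Coprime j → k.Coprime r := by
    intro k j h hc
    rw [← h]
    exact (Nat.coprime_mul_right_add_right k j 2).2 hc
  rcases Nat.even_or_odd' r with ⟨s, hs | hs⟩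
  · rcases Nat.even_or_odd' s with ⟨u, hu | hu⟩
    · refine ⟨s - 1, 2, by omega, by omega, by omega, key _ 2 (by omega) ?_⟩
      rw [Nat.coprime_two_right]
      exact ⟨u - 1, by omega⟩
    · refine ⟨s - 2, 4, by omega, by omega, by omega, key _ 4 (by omega) ?_⟩
      rw [show 4 = 2 ^ 2 by norm_num]
      apply Nat.Coprime.pow_right
      rw [Nat.coprime_two_right]
      exact ⟨u - 1, by omega⟩
  · exact ⟨s, 1, by omega, by omega, by omega, key s 1 (by omega) (Nat.coprime_one_right s)⟩

theorem q_pow_re {r k : ℕ} : (q r ^ k).re = Real.cos (k * (2 * Real.pi / r)) := by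
  have e : q r ^ k = Complex.exp ((k * (2 * Real.pi / r) : ℝ) * Complex.I) := by
    rw [q, ← Complex.exp_nat_mul]
    congr 1
    push_cast
    ring
  rw [e, Complex.exp_ofReal_mul_I_re]

theorem q_pow_re_lt {r k j : ℕ} (h : 2 * k + j = r) (hj : 0 < j) (h3 : 3 * j < r) :
    (q r ^ k).re < -(1 / 2) := by
  have hr : (0 : ℝ) < r := by exact_mod_cast (by omega : 0 < r)
  have hj' : (0 : ℝ) < j := by exact_mod_cast hj
  have h3' : (3 : ℝ) * j < r := by exact_mod_cast h3
  have hk : (2 : ℝ) * k + j = r := by exact_mod_cast h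
  have e : (k : ℝ) * (2 * Real.pi / r) = Real.pi - j * Real.pi / r := by
    field_simp
    linear_combination hk
  rw [q_pow_re, e, Real.cos_pi_sub, ← Real.cos_pi_div_three]
  apply neg_lt_neg
  have hpi := Real.pi_pos
  apply Real.cos_lt_cos_of_nonneg_of_le_pi
  · positivity
  · linarith
  · rw [div_lt_div_iff₀ hr (by norm_num)]
    nlinarith

/-- If `x ^ N = 1`, then `x` and `q` are powers of one root of unity `ζ` of order `N * r`. A
conjugation with `q ↦ q ^ k` sends `x` to some `y` of modulus `1` with `y + y⁻¹ = 1 - 2 Re q ^ k >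
2`. -/
theorem not_isRoot_of_unity {r : ℕ} (hr : 5 ≤ r) (h6 : r ≠ 6) (h10 : r ≠ 10) {x : ℂ}
    (hx : x + x⁻¹ = 1 - q r - (q r)⁻¹) {N : ℕ} (hN : 0 < N) : x ^ N ≠ 1 := by
  intro hxN
  obtain ⟨k, j, hkj, hj, h3, hk⟩ := exists_coprime_near_half hr h6 h10
  have hM : 0 < N * r := Nat.mul_pos hN (by omega)
  obtain ⟨l, hl, hlk⟩ := exists_coprime_modEq hM (Dvd.intro_left N rfl) hk
  have hζ := Complex.isPrimitiveRoot_exp (N * r) hM.ne'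
  have hq : Complex.exp (2 * Real.pi * Complex.I / (N * r : ℕ)) ^ N = q r := by
    rw [q, ← Complex.exp_nat_mul]
    congr 1
    have : (N : ℂ) ≠ 0 := by exact_mod_cast hN.ne'
    push_cast
    field_simp
  generalize Complex.exp (2 * Real.pi * Complex.I / (N * r : ℕ)) = ζ at *
  have : NeZero (N * r) := ⟨hM.ne'⟩
  obtain ⟨a, -, ha⟩ := hζ.eq_pow_of_pow_eq_one (show x ^ (N * r) = 1 by rw [pow_mul, hxN, one_pow])
  have hx0 : x ≠ 0 := by
    rintro rfl
    simp [hN.ne'] at hxN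
  have hq0 := q_ne_zero r
  -- This is the relation for `x` multiplied by `x q`, with `x = ζ ^ a` and `q = ζ ^ N`.
  have hP : Polynomial.aeval ζ (Polynomial.X ^ (2 * a + N) + Polynomial.X ^ N -
      Polynomial.X ^ (a + N) + Polynomial.X ^ (a + 2 * N) + Polynomial.X ^ a :
        Polynomial ℤ) = 0 := by
    simp only [map_add, map_sub, map_pow, Polynomial.aeval_X]
    have e1 : ζ ^ (2 * a + N) = x ^ 2 * q r := by rw [← hq, ← ha]; ring
    have e2 : ζ ^ (a + N) = x * q r := by rw [← hq, ← ha]; ring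
    have e3 : ζ ^ (a + 2 * N) = x * q r ^ 2 := by rw [← hq, ← ha]; ring
    rw [e1, e2, e3, ha, hq]
    field_simp at hx
    linear_combination hx
  have h := aeval_pow_eq_zero_of_coprime hM hζ hl hP
  have hql : (ζ ^ l) ^ N = q r ^ k := by
    rw [← pow_mul, mul_comm, pow_mul, hq,
      pow_eq_pow_mod l (q_isPrimitiveRoot (r := r) (by omega)).pow_eq_one, hlk,
      ← pow_eq_pow_mod k (q_isPrimitiveRoot (r := r) (by omega)).pow_eq_one]
  have hz1 : ‖(ζ ^ l) ^ a‖ = 1 := by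
    rw [← pow_mul, mul_comm, pow_mul, ha, norm_pow,
      Complex.norm_eq_one_of_pow_eq_one hxN hN.ne', one_pow]
  have hq1 : ‖q r ^ k‖ = 1 := by
    rw [norm_pow, Complex.norm_eq_one_of_pow_eq_one
      (q_isPrimitiveRoot (r := r) (by omega)).pow_eq_one (by omega), one_pow]
  have hre := q_pow_re_lt hkj hj h3
  simp only [map_add, map_sub, map_pow, Polynomial.aeval_X] at h
  rw [pow_add, pow_add, pow_add, mul_comm 2 a, mul_comm 2 N, pow_mul (ζ ^ l) N 2,
    pow_mul (ζ ^ l) a 2, hql] at h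
  generalize (ζ ^ l) ^ a = y at *
  generalize q r ^ k = p at *
  have hy0 : y ≠ 0 := by
    rintro rfl
    simp at hz1
  have hp0 : p ≠ 0 := by
    rintro rfl
    simp at hq1
  have hrel : y + y⁻¹ = 1 - p - p⁻¹ := by
    field_simp
    linear_combination h
  have hinv : ∀ z : ℂ, ‖z‖ = 1 → (z⁻¹).re = z.re := by
    intro z hz
    rw [Complex.inv_re, Complex.normSq_eq_norm_sq, hz]
    simp
  have h2 := congrArg Complex.re hrel
  simp only [Complex.add_re, Complex.sub_re, Complex.one_re, hinv y hz1, hinv p hq1] at h2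
  have h4 := Complex.re_le_norm y
  rw [hz1] at h4
  linarith

/-- If a power of `(a - (1 + a) E) (b - (1 + b) F)`, with `a b = 1`, commutes with both of the
Temperley-Lieb projections `E` and `F`, then the eigenvalues of the product are roots of unity. -/
theorem pow_two_mul_eq_one_of_commute {V : Type*} [AddCommGroup V] [Module ℂ V]
    {E F : Module.End ℂ V} {a b τ : ℂ} (hE : E * E = E) (hF : F * F = F)
    (hEFE : E * F * E = τ • E) (hτ0 : τ ≠ 0) (hτ1 : τ ≠ 1) (hE0 : E ≠ 0)
    (hab : a * b = 1) (ha : 1 + a ≠ 0) (hτ : (1 + a) ^ 2 * τ = a) {N : ℕ}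
    (hcE : Commute (((a • 1 - (1 + a) • E) * (b • 1 - (1 + b) • F)) ^ N) E)
    (hcF : Commute (((a • 1 - (1 + a) • E) * (b • 1 - (1 + b) • F)) ^ N) F)
    {x : ℂ} (hx : x + x⁻¹ = 1 - a - b) (hx0 : x ≠ 0) : x ^ (2 * N) = 1 := by
  obtain ⟨v₀, hv₀⟩ : ∃ v₀, E v₀ ≠ 0 := by
    by_contra hc
    push Not at hc
    exact hE0 (LinearMap.ext hc)
  obtain ⟨v, hv⟩ : ∃ v, v = E v₀ := ⟨_, rfl⟩
  obtain ⟨w, hw⟩ : ∃ w, w = F v := ⟨_, rfl⟩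
  rw [← hv] at hv₀
  have Ev : E v = v := by
    rw [hv, ← Module.End.mul_apply, hE]
  have Ew : E w = τ • v := by
    have := LinearMap.congr_fun hEFE v₀
    rwa [Module.End.mul_apply, Module.End.mul_apply, LinearMap.smul_apply, ← hv, ← hw] at this
  have Fw : F w = w := by
    rw [hw, ← Module.End.mul_apply, hF]
  have hw0 : w ≠ 0 := by
    rintro h
    rw [h, map_zero] at Ew
    exact smul_ne_zero hτ0 hv₀ Ew.symm
  -- Applying `E` and `F` to a relation gives `c + d τ = 0` and `c + d = 0`, and `τ ≠ 1`.
  have hli : ∀ c d : ℂ, c • v + d • w = 0 → d = 0 := by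
    intro c d h
    have h1 := congrArg E h
    have h2 := congrArg F h
    rw [map_add, map_smul, map_smul, map_zero, Ev, Ew, smul_smul, ← add_smul] at h1
    rw [map_add, map_smul, map_smul, map_zero, ← hw, Fw, ← add_smul] at h2
    have h1 := (smul_eq_zero.1 h1).resolve_right hv₀
    have h2 := (smul_eq_zero.1 h2).resolve_right hw0
    have h3 : d * (τ - 1) = 0 := by linear_combination h1 - h2
    exact (mul_eq_zero.1 h3).resolve_right (sub_ne_zero.2 hτ1)
  obtain ⟨h, hh⟩ : ∃ h : Module.End ℂ V,
      h = (a • 1 - (1 + a) • E) * (b • 1 - (1 + b) • F) := ⟨_, rfl⟩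
  rw [← hh] at hcE hcF
  have hb : (1 + a) * (1 + b) * τ = 1 := by
    linear_combination b * hτ + hab - (1 + a) * τ * hab
  have hv : h v = (1 - b) • v - (1 + a) • w := by
    simp only [hh, Module.End.mul_apply, LinearMap.sub_apply, LinearMap.smul_apply,
      Module.End.one_apply, map_sub, map_smul, Ev, Ew, ← hw]
    match_scalars
    · linear_combination hb
    · linear_combination -hab
  have hw' : h w = ((1 + a) * τ) • v - a • w := by
    simp only [hh, Module.End.mul_apply, LinearMap.sub_apply, LinearMap.smul_apply,
      Module.End.one_apply, map_sub, map_smul, Ew, Fw]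
    match_scalars <;> ring
  have hspan : ∀ (k : ℕ) (c d : ℂ), ∃ c' d' : ℂ, (h ^ k) (c • v + d • w) = c' • v + d' • w := by
    intro k
    induction k with
    | zero => exact fun c d => ⟨c, d, rfl⟩
    | succ k ih =>
      intro c d
      obtain ⟨c', d', e⟩ := ih (c * (1 - b) + d * ((1 + a) * τ)) (-c * (1 + a) - d * a)
      refine ⟨c', d', ?_⟩
      rw [← e, pow_succ, Module.End.mul_apply, map_add, map_smul, map_smul, hv, hw']
      congr 1
      module
  -- The power of `h` commutes with `E`, so it maps `v` into the range of `E`, which meets the plane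
  -- only in the line of `v`; hence `d = 0`. Commuting with `F` gives the same scalar `c` on `w = F
  -- v`.
  obtain ⟨c, d, hcd⟩ := hspan N 1 0
  rw [one_smul, zero_smul, add_zero] at hcd
  have hd : d = 0 := by
    have h1 := LinearMap.congr_fun hcE.eq v
    rw [Module.End.mul_apply, Module.End.mul_apply, Ev, hcd, map_add, map_smul, map_smul, Ev,
      Ew] at h1
    apply hli (-(d * τ)) d
    rw [add_left_cancel h1]
    module
  rw [hd, zero_smul, add_zero] at hcd
  have hcw : (h ^ N) w = c • w := by
    have h1 := LinearMap.congr_fun hcF.eq v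
    rwa [Module.End.mul_apply, Module.End.mul_apply, hcd, map_smul, ← hw] at h1
  have key : ∀ y : ℂ, y ≠ 0 → y + y⁻¹ = 1 - a - b → y ^ N = c := by
    intro y hy0 hy
    -- On the plane `h` has trace `1 - a - b` and determinant `1`; this `u` is its eigenvector for
    -- the root `y`.
    obtain ⟨u, hu⟩ : ∃ u, u = (1 - b - y⁻¹) • v - (1 + a) • w := ⟨_, rfl⟩
    have hu0 : u ≠ 0 := by
      intro h0
      apply ha
      have := hli (1 - b - y⁻¹) (-(1 + a)) (by rw [← h0, hu]; module)
      linear_combination -this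
    have hyi : y * y⁻¹ = 1 := mul_inv_cancel₀ hy0
    have hyu : h u = y • u := by
      rw [hu, map_sub, map_smul, map_smul, hv, hw']
      match_scalars
      · linear_combination -(1 - b) * hy + hyi - hτ - hab
      · linear_combination (1 + a) * hy
    have hpow : ∀ k : ℕ, (h ^ k) u = y ^ k • u := by
      intro k
      induction k with
      | zero => simp
      | succ k ih =>
        rw [pow_succ, Module.End.mul_apply, hyu, map_smul, ih, smul_smul, pow_succ, mul_comm]
    have h1 := hpow N
    have h2 : (h ^ N) u = c • u := by
      rw [hu, map_sub, map_smul, map_smul, hcd, hcw]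
      module
    rw [h2] at h1
    exact (smul_left_injective ℂ hu0 h1).symm
  -- Both eigenvalues have the same power: `x ^ N = c = x⁻¹ ^ N`.
  have k1 := key x hx0 hx
  have k2 := key x⁻¹ (inv_ne_zero hx0) (by rw [inv_inv, add_comm, hx])
  rw [two_mul, pow_add]
  nth_rewrite 2 [k1]
  rw [← k2, ← mul_pow, mul_inv_cancel₀ hx0, one_pow]

/-! ### The group generated by the first two generators -/

section infinite

variable {r n : ℕ} {μ : YoungDiagram}

open Tableau

/-- Since `(1 + q)² = q [2]²`, the value `1` would give `q² + q + 1 = 0`, hence `q³ = 1`. -/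
theorem qInt_two_sq_ne_one (hr : 4 ≤ r) : ((qInt r 2 : ℝ) : ℂ) ^ 2 ≠ 1 := by
  intro h
  have h1 := q_qInt (r := r) (by omega)
  rw [h, mul_one] at h1
  apply q_zpow_ne_one (r := r) (k := 3) (by omega) (by omega) (by omega) (by omega)
  rw [show (3 : ℤ) = ((3 : ℕ) : ℤ) from rfl, zpow_natCast]
  linear_combination (q r - 1) * h1

/-- The first projector has a diagonal entry `1`. If `e_{i+1}` vanished, `e_i e_{i+1} e_i = [2]⁻²
e_i` would make `e_i` vanish too. -/
theorem projector_ne_zero (hr : 3 ≤ r) (hμ : IsTwoRow r μ) (hn : μ.card = n)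
    (h1 : 0 < μ.rowLen 1) (i : Fin (n - 1)) : projector r n μ i ≠ 0 := by
  obtain ⟨i, hi⟩ := i
  induction i with
  | zero =>
    obtain ⟨t, ht⟩ := exists_d_eq_one hr hμ hn h1 ⟨0, hi⟩ rfl
    intro h
    have h2 := congrFun (congrFun h t) t
    rw [projector, Matrix.of_apply, if_pos rfl, alpha_eq, ht, alphaOf_one hr] at h2
    simp at h2
  | succ i ih =>
    intro h
    have hb := projector_braid (μ := μ) hr ⟨i, by omega⟩ ⟨i + 1, hi⟩ (Or.inl rfl)
    rw [h, mul_zero, zero_mul] at hb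
    have h2 : (((qInt r 2 : ℝ) : ℂ) ^ 2)⁻¹ ≠ 0 :=
      inv_ne_zero (pow_ne_zero _ (by exact_mod_cast two_ne hr))
    exact ih (by omega) ((smul_eq_zero.1 hb.symm).resolve_left h2)

theorem sector_σ (hr : 3 ≤ r) (i : Fin (n - 1)) :
    sector r n hr μ (BraidGroup.σ i) = sigmaUnitary r n hr μ i := by
  rw [sector, BraidGroup.σ, PresentedGroup.toGroup.of]

theorem star_q (r : ℕ) : star (q r) = (q r)⁻¹ :=
  eq_inv_of_mul_eq_one_right (norm_q r)

/-- No power of `σ₁ σ₂⁻¹` commutes with both `σ₁` and `σ₂`. -/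
theorem not_commute_pow (hr : 3 ≤ r) (hn : 3 ≤ n) (hμ : IsTwoRow r μ) (hc : μ.card = n)
    (h1 : 0 < μ.rowLen 1) (h3 : r ≠ 3) (h4 : r ≠ 4) (h6 : r ≠ 6) (h10 : r ≠ 10) {N : ℕ}
    (hN : 0 < N)
    (c1 : Commute ((sigmaUnitary r n hr μ ⟨0, by omega⟩ *
      (sigmaUnitary r n hr μ ⟨1, by omega⟩)⁻¹) ^ N) (sigmaUnitary r n hr μ ⟨0, by omega⟩))
    (c2 : Commute ((sigmaUnitary r n hr μ ⟨0, by omega⟩ *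
      (sigmaUnitary r n hr μ ⟨1, by omega⟩)⁻¹) ^ N) (sigmaUnitary r n hr μ ⟨1, by omega⟩)) :
    False := by
  have hp := one_add_q_ne_zero hr
  let φ : Matrix (Tableau r n μ) (Tableau r n μ) ℂ ≃ₐ[ℂ] _ := Matrix.toLinAlgEquiv'
  let E := projector r n μ ⟨0, by omega⟩
  let F := projector r n μ ⟨1, by omega⟩
  have hinv : (((sigmaUnitary r n hr μ ⟨1, by omega⟩)⁻¹ :
      Matrix.unitaryGroup (Tableau r n μ) ℂ) : Matrix (Tableau r n μ) (Tableau r n μ) ℂ) =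
      (q r)⁻¹ • 1 - (1 + (q r)⁻¹) • F := by
    change star (sigmaMatrix r n μ _) = _
    rw [sigmaMatrix, star_sub, star_smul, star_smul, star_one, projector_star hr, star_add,
      star_one, star_q]
  obtain ⟨g, hg⟩ : ∃ g, g = ((q r • 1 - (1 + q r) • E) *
    ((q r)⁻¹ • 1 - (1 + (q r)⁻¹) • F)) ^ N := ⟨_, rfl⟩
  have hpow : (((sigmaUnitary r n hr μ ⟨0, by omega⟩ *
      (sigmaUnitary r n hr μ ⟨1, by omega⟩)⁻¹) ^ N :
      Matrix.unitaryGroup (Tableau r n μ) ℂ) : Matrix (Tableau r n μ) (Tableau r n μ) ℂ) = g := by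
    rw [hg, ← hinv]
    rfl
  -- As `1 + q ≠ 0`, the projector is a linear combination of `1` and `σ`.
  have hcomm : ∀ P : Matrix (Tableau r n μ) (Tableau r n μ) ℂ,
      Commute g (q r • 1 - (1 + q r) • P) → Commute g P := by
    intro P hP
    have e : P = (1 + q r)⁻¹ • (q r • 1 - (q r • 1 - (1 + q r) • P)) := by
      rw [sub_sub_cancel, inv_smul_smul₀ hp]
    rw [e]
    exact (((Commute.one_right g).smul_right _).sub_right hP).smul_right _
  have cE : Commute g E := hcomm E (by
    rw [← hpow]
    exact congrArg Subtype.val c1.eq)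
  have cF : Commute g F := hcomm F (by
    rw [← hpow]
    exact congrArg Subtype.val c2.eq)
  have hφg : φ g = ((q r • 1 - (1 + q r) • φ E) *
      ((q r)⁻¹ • 1 - (1 + (q r)⁻¹) • φ F)) ^ N := by
    simp only [hg, map_pow, map_mul, map_sub, map_smul, map_one]
  have h2q : ((qInt r 2 : ℝ) : ℂ) ^ 2 ≠ 0 := pow_ne_zero _ (by exact_mod_cast two_ne hr)
  -- `s` is a square root of the discriminant of `X² - (1 - q - q⁻¹) X + 1`; the two roots are `x`
  -- and `x⁻¹`.
  obtain ⟨s, hs⟩ := IsAlgClosed.exists_pow_nat_eq ((1 - q r - (q r)⁻¹) ^ 2 - 4) (n := 2) (by omega)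
  have hx : (1 - q r - (q r)⁻¹ + s) / 2 * ((1 - q r - (q r)⁻¹ - s) / 2) = 1 := by
    linear_combination -hs / 4
  have hx0 := left_ne_zero_of_mul_eq_one hx
  have hxx : (1 - q r - (q r)⁻¹ + s) / 2 + ((1 - q r - (q r)⁻¹ + s) / 2)⁻¹ =
      1 - q r - (q r)⁻¹ := by
    rw [← eq_inv_of_mul_eq_one_right hx]
    ring
  refine not_isRoot_of_unity (r := r) (by omega) h6 h10 hxx (N := 2 * N) (by omega)
    (pow_two_mul_eq_one_of_commute (E := φ E) (F := φ F) (τ := (((qInt r 2 : ℝ) : ℂ) ^ 2)⁻¹)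
      ?_ ?_ ?_ (inv_ne_zero h2q) (inv_ne_one.2 (qInt_two_sq_ne_one (by omega))) ?_
      (mul_inv_cancel₀ (q_ne_zero r)) hp ?_ ?_ ?_ hxx hx0)
  · rw [← map_mul, projector_mul_self hr]
  · rw [← map_mul, projector_mul_self hr]
  · rw [← map_mul, ← map_mul, projector_braid hr _ _ (Or.inl rfl), map_smul]
  · exact (map_ne_zero_iff φ φ.injective).2 (projector_ne_zero hr hμ hc h1 _)
  · rw [q_qInt hr, mul_assoc, mul_inv_cancel₀ h2q, mul_one]
  · rw [← hφg]
    exact cE.map φ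
  · rw [← hφg]
    exact cF.map φ

/-- In a finite quotient the class of `σ₁ σ₂⁻¹` has finite order. The corresponding power lies in
the respective centre, and either centre commutes with `σ₁` and `σ₂`. -/
theorem infinite_mod_center (hr : 3 ≤ r) (hn : 3 ≤ n) (hμ : IsTwoRow r μ) (hc : μ.card = n)
    (h1 : 0 < μ.rowLen 1) (h3 : r ≠ 3) (h4 : r ≠ 4) (h6 : r ≠ 6) (h10 : r ≠ 10) :
    Infinite ((firstTwo r n hr hn μ).map (QuotientGroup.mk'
      (Subgroup.center (Matrix.unitaryGroup (Tableau r n μ) ℂ)))) ∧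
    Infinite (firstTwo r n hr hn μ ⧸ Subgroup.center (firstTwo r n hr hn μ)) := by
  have key := fun (N : ℕ) (hN : 0 < N) c1 c2 =>
    not_commute_pow hr hn hμ hc h1 h3 h4 h6 h10 (N := N) hN c1 c2
  have m1 : sigmaUnitary r n hr μ ⟨0, by omega⟩ ∈ firstTwo r n hr hn μ := by
    rw [← sector_σ]
    exact Subgroup.subset_closure (Or.inl rfl)
  have m2 : sigmaUnitary r n hr μ ⟨1, by omega⟩ ∈ firstTwo r n hr hn μ := by
    rw [← sector_σ]
    exact Subgroup.subset_closure (Or.inr rfl)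
  have mh := Subgroup.mul_mem _ m1 (Subgroup.inv_mem _ m2)
  constructor
  · rw [← not_finite_iff_infinite]
    intro hfin
    obtain ⟨N, hN, e⟩ := isOfFinOrder_iff_pow_eq_one.1 (isOfFinOrder_of_finite
      (⟨_, Subgroup.mem_map_of_mem _ mh⟩ : (firstTwo r n hr hn μ).map (QuotientGroup.mk'
        (Subgroup.center (Matrix.unitaryGroup (Tableau r n μ) ℂ)))))
    have e' := congrArg Subtype.val e
    simp only [SubmonoidClass.mk_pow, ← map_pow, OneMemClass.coe_one] at e'
    rw [QuotientGroup.mk'_apply, QuotientGroup.eq_one_iff, Subgroup.mem_center_iff] at e'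
    exact key N hN (e' _).symm (e' _).symm
  · rw [← not_finite_iff_infinite]
    intro hfin
    obtain ⟨N, hN, e⟩ := isOfFinOrder_iff_pow_eq_one.1 (isOfFinOrder_of_finite
      (QuotientGroup.mk' (Subgroup.center (firstTwo r n hr hn μ)) ⟨_, mh⟩))
    rw [← map_pow, QuotientGroup.mk'_apply, QuotientGroup.eq_one_iff,
      Subgroup.mem_center_iff] at e
    exact key N hN (congrArg Subtype.val (e ⟨_, m1⟩)).symm
      (congrArg Subtype.val (e ⟨_, m2⟩)).symm

end infinite

/-! ### Eigenvalues -/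

section eigenvalues

variable {r n : ℕ} {μ : YoungDiagram}

open Tableau

theorem hasEigenvalue_σ_iff (hr : 3 ≤ r) (i : Fin (n - 1)) (z : ℂ) :
    Module.End.HasEigenvalue (sectorRep r n hr μ (BraidGroup.σ i)) z ↔
      ∃ f : Tableau r n μ → ℂ, f ≠ 0 ∧ (sigmaMatrix r n μ i).mulVec f = z • f := by
  constructor
  · intro h
    obtain ⟨f, hf⟩ := h.exists_hasEigenvector
    exact ⟨f, hf.2, by rw [← sectorRep_σ hr, hf.apply_eq_smul]⟩
  · rintro ⟨f, f0, hf⟩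
    exact Module.End.hasEigenvalue_of_hasEigenvector
      ⟨Module.End.mem_eigenspace_iff.2 (by rw [sectorRep_σ hr, hf]), f0⟩

theorem projector_projector (hr : 3 ≤ r) (i : Fin (n - 1)) (f : Tableau r n μ → ℂ) :
    (projector r n μ i).mulVec ((projector r n μ i).mulVec f) = (projector r n μ i).mulVec f := by
  rw [Matrix.mulVec_mulVec, projector_mul_self hr]

/-- The eigenspaces of the generators are the range and the kernel of the projector. -/
theorem sigmaMatrix_mulVec_eq_neg_iff (hr : 3 ≤ r) (i : Fin (n - 1)) (f : Tableau r n μ → ℂ) :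
    (sigmaMatrix r n μ i).mulVec f = (-1 : ℂ) • f ↔ (projector r n μ i).mulVec f = f := by
  have hp := one_add_q_ne_zero hr
  rw [sigmaMatrix_mulVec]
  constructor
  · intro h
    have h1 : (1 + q r) • (projector r n μ i).mulVec f = (1 + q r) • f := by
      rw [sub_eq_iff_eq_add] at h
      rw [add_smul 1 (q r) f, h]
      module
    exact smul_right_injective _ hp h1
  · intro h
    rw [h]
    module

theorem sigmaMatrix_mulVec_eq_q_iff (hr : 3 ≤ r) (i : Fin (n - 1)) (f : Tableau r n μ → ℂ) :
    (sigmaMatrix r n μ i).mulVec f = q r • f ↔ (projector r n μ i).mulVec f = 0 := by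
  rw [sigmaMatrix_mulVec, sub_eq_self, smul_eq_zero, or_iff_right (one_add_q_ne_zero hr)]

/-- An eigenvector `f` with `e_i f ≠ 0` has `z = -1`, because `e_i σ_i = -e_i`; otherwise `f` is in
the kernel, where `σ_i = q`. -/
theorem eigenvalue_eq (hr : 3 ≤ r) (i : Fin (n - 1)) {z : ℂ}
    (h : Module.End.HasEigenvalue (sectorRep r n hr μ (BraidGroup.σ i)) z) :
    z = -1 ∨ z = q r := by
  obtain ⟨f, f0, hf⟩ := (hasEigenvalue_σ_iff hr i z).1 h
  by_cases he : (projector r n μ i).mulVec f = 0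
  · rw [(sigmaMatrix_mulVec_eq_q_iff hr i f).2 he] at hf
    exact Or.inr (smul_left_injective ℂ f0 hf).symm
  · left
    have h1 := congrArg (projector r n μ i).mulVec hf
    rw [sigmaMatrix_mulVec, Matrix.mulVec_sub, Matrix.mulVec_smul, Matrix.mulVec_smul,
      projector_projector hr, Matrix.mulVec_smul, ← sub_smul] at h1
    have h2 := smul_left_injective ℂ he h1
    linear_combination -h2

/-- If `e_i = 1`, a neighbour satisfies `e_j = e_j e_i e_j = [2]⁻² e_j`, although `e_j ≠ 0` and
`[2]² ≠ 1`. -/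
theorem projector_ne_one (hr : 4 ≤ r) (hn : 3 ≤ n) (hμ : IsTwoRow r μ) (hc : μ.card = n)
    (h1 : 0 < μ.rowLen 1) (i : Fin (n - 1)) : projector r n μ i ≠ 1 := by
  intro h
  obtain ⟨j, hj⟩ : ∃ j : Fin (n - 1), j.val + 1 = i.val ∨ i.val + 1 = j.val := by
    by_cases h0 : i.val = 0
    · exact ⟨⟨1, by omega⟩, Or.inr (by simp [h0])⟩
    · exact ⟨⟨i.val - 1, by omega⟩, Or.inl (by simp; omega)⟩
  have hb := projector_braid (μ := μ) (by omega : 3 ≤ r) j i hj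
  rw [h, mul_one, projector_mul_self (by omega)] at hb
  have h2 : ((1 : ℂ) - (((qInt r 2 : ℝ) : ℂ) ^ 2)⁻¹) • projector r n μ j = 0 := by
    rw [sub_smul, one_smul, ← hb, sub_self]
  have h3 := (smul_eq_zero.1 h2).resolve_right (projector_ne_zero (by omega) hμ hc h1 j)
  exact inv_ne_one.2 (qInt_two_sq_ne_one hr) (sub_eq_zero.1 h3).symm

theorem hasEigenvalue_iff (hr : 4 ≤ r) (hn : 3 ≤ n) (hμ : IsTwoRow r μ) (hc : μ.card = n)
    (h1 : 0 < μ.rowLen 1) (i : Fin (n - 1)) (z : ℂ) :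
    Module.End.HasEigenvalue (sectorRep r n (by omega) μ (BraidGroup.σ i)) z ↔
      z = -1 ∨ z = q r := by
  have hr' : 3 ≤ r := by omega
  refine ⟨eigenvalue_eq hr' i, ?_⟩
  rintro (rfl | rfl)
  · obtain ⟨f, hf⟩ : ∃ f, (projector r n μ i).mulVec f ≠ 0 := by
      by_contra hc'
      push Not at hc'
      refine projector_ne_zero hr' hμ hc h1 i (Matrix.ext_of_mulVec_single fun k => ?_)
      rw [hc', Matrix.zero_mulVec]
    exact (hasEigenvalue_σ_iff hr' i _).2
      ⟨_, hf, (sigmaMatrix_mulVec_eq_neg_iff hr' i _).2 (projector_projector hr' i f)⟩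
  · obtain ⟨f, hf⟩ : ∃ f, (projector r n μ i).mulVec f ≠ f := by
      by_contra hc'
      push Not at hc'
      refine projector_ne_one hr hn hμ hc h1 i (Matrix.ext_of_mulVec_single fun k => ?_)
      rw [hc', Matrix.one_mulVec]
    refine (hasEigenvalue_σ_iff hr' i _).2
      ⟨f - (projector r n μ i).mulVec f, sub_ne_zero.2 hf.symm, ?_⟩
    rw [sigmaMatrix_mulVec_eq_q_iff hr', Matrix.mulVec_sub, projector_projector hr', sub_self]

/-! ### Multiplicities -/

/-- For neighbours, `[2]⁻² tr e_i = tr (e_i e_j e_i) = tr (e_i e_j)` is symmetric in `i` and `j`. -/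
theorem trace_projector_eq (hr : 3 ≤ r) (i j : Fin (n - 1)) :
    (projector r n μ i).trace = (projector r n μ j).trace := by
  have h2q : (((qInt r 2 : ℝ) : ℂ) ^ 2)⁻¹ ≠ 0 :=
    inv_ne_zero (pow_ne_zero _ (by exact_mod_cast two_ne hr))
  have near : ∀ i j : Fin (n - 1), i.val + 1 = j.val →
      (projector r n μ i).trace = (projector r n μ j).trace := by
    intro i j hij
    have h1 := congrArg Matrix.trace (projector_braid (μ := μ) hr i j (Or.inl hij))
    have h2 := congrArg Matrix.trace (projector_braid (μ := μ) hr j i (Or.inr hij))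
    rw [Matrix.trace_mul_comm, ← mul_assoc, projector_mul_self hr, Matrix.trace_smul] at h1 h2
    rw [Matrix.trace_mul_comm, h1] at h2
    exact smul_right_injective ℂ h2q h2
  have zero : ∀ (k : ℕ) (hk : k < n - 1),
      (projector r n μ ⟨k, hk⟩).trace = (projector r n μ ⟨0, by omega⟩).trace := by
    intro k
    induction k with
    | zero => exact fun _ => rfl
    | succ k ih => exact fun hk => (near ⟨k, by omega⟩ ⟨k + 1, hk⟩ rfl).symm.trans (ih _)
  exact (zero i i.isLt).trans (zero j j.isLt).symm

/-- The entry `0` is in the corner, so `d = 1` and `α = 1` if the entry `1` is below it, and `d =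
-1` and `α = 0` if it is to the right. -/
theorem trace_projector_zero (hr : 3 ≤ r) (i : Fin (n - 1)) (hi : i.val = 0) :
    (projector r n μ i).trace =
      ((Finset.univ.filter fun t : Tableau r n μ => t.inSecond 1 = true).card : ℂ) := by
  rw [Matrix.trace, Finset.card_filter, Nat.cast_sum]
  refine Finset.sum_congr rfl fun t _ => ?_
  have h0 : t.inSecond i = false := by
    by_contra hc
    have h1 := t.two_mul_downs_le (m := i + 1) (by omega)
    rw [downs_succ, if_pos (by simpa using hc)] at h1
    omega
  rw [Matrix.diag_apply, projector, Matrix.of_apply, if_pos rfl, alpha_eq]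
  have e1 : t.inSecond 1 = t.inSecond (i + 1) := by rw [hi]
  split_ifs with h
  · rw [t.d_of_peak i h0 (e1 ▸ h), hi, downs_zero]
    simpa using alphaOf_one hr
  · rw [t.d_of_same i (by rw [h0, ← e1]; simpa using h), alphaOf_neg_one]
    simp

/-- The multiplicities of the two eigenvalues from the trace of the projector. -/
theorem finrank_eigenspaces (hr : 3 ≤ r) (i : Fin (n - 1)) :
    (Module.finrank ℂ (Module.End.eigenspace (sectorRep r n hr μ (BraidGroup.σ i)) (-1)) : ℂ) =
      (projector r n μ i).trace ∧
    Module.finrank ℂ (Module.End.eigenspace (sectorRep r n hr μ (BraidGroup.σ i)) (-1)) +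
      Module.finrank ℂ (Module.End.eigenspace (sectorRep r n hr μ (BraidGroup.σ i)) (q r)) =
      Fintype.card (Tableau r n μ) := by
  have hid : IsIdempotentElem (Matrix.toLin' (projector r n μ i)) := by
    rw [IsIdempotentElem, Module.End.mul_eq_comp, ← Matrix.toLin'_mul, projector_mul_self hr]
  have e1 : Module.End.eigenspace (sectorRep r n hr μ (BraidGroup.σ i)) (-1) =
      (Matrix.toLin' (projector r n μ i)).range := by
    ext f
    rw [Module.End.mem_eigenspace_iff, sectorRep_σ hr, sigmaMatrix_mulVec_eq_neg_iff hr]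
    constructor
    · exact fun h => ⟨f, h⟩
    · rintro ⟨g, rfl⟩
      exact projector_projector hr i g
  have e2 : Module.End.eigenspace (sectorRep r n hr μ (BraidGroup.σ i)) (q r) =
      (Matrix.toLin' (projector r n μ i)).ker := by
    ext f
    rw [Module.End.mem_eigenspace_iff, sectorRep_σ hr, sigmaMatrix_mulVec_eq_q_iff hr]
    rfl
  rw [e1, e2]
  refine ⟨?_, ?_⟩
  · rw [← (LinearMap.IsIdempotentElem.isProj_range _ hid).trace, Matrix.trace_toLin'_eq]
  · rw [LinearMap.finrank_range_add_finrank_ker, Module.finrank_fintype_fun_eq_card]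

end eigenvalues

/-! ### The count for `[4, 2]` and `r = 5` -/

section counting

open Tableau

theorem rowLen_diagram42 : diagram42.rowLen 0 = 4 ∧ diagram42.rowLen 1 = 2 := by
  have hw : [4, 2].SortedGE := by simp [List.sortedGE_iff_pairwise]
  have h0 := YoungDiagram.rowLen_ofRowLens (w := [4, 2]) (hw := hw) ⟨0, by simp⟩
  have h1 := YoungDiagram.rowLen_ofRowLens (w := [4, 2]) (hw := hw) ⟨1, by simp⟩
  exact ⟨h0, h1⟩

theorem isTwoRow_diagram42 : IsTwoRow 5 diagram42 := by
  refine ⟨?_, ?_⟩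
  · by_contra hc
    have h : (2, 0) ∈ diagram42 := YoungDiagram.mem_iff_lt_colLen.2 (by omega)
    rw [diagram42, YoungDiagram.mem_ofRowLens] at h
    simp at h
  · rw [rowLen_diagram42.1, rowLen_diagram42.2]
    norm_num

theorem card_diagram42 : diagram42.card = 6 := by
  rw [isTwoRow_diagram42.card_eq, rowLen_diagram42.1, rowLen_diagram42.2]

/-- Extension of a finite word by `false`. -/
def extendWord (w : Fin 6 → Bool) (j : ℕ) : Bool := if h : j < 6 then w ⟨j, h⟩ else false

/-- The row words of the tableaux of shape `[4, 2]` for `r = 5`. -/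
def words42 : Finset (Fin 6 → Bool) :=
  Finset.univ.filter fun w =>
    (∀ m : Fin 7, 2 * Nat.count (fun k => extendWord w k = true) m ≤ m ∧
      m + 2 ≤ 2 * Nat.count (fun k => extendWord w k = true) m + 5) ∧
    Nat.count (fun k => extendWord w k = true) 6 = 2

/-- Of the nine standard tableaux only the one through `[4]` is lost, as its height `4` exceeds `r -
2 = 3`. The second count is the trace of the first projector. -/
theorem card_words42 : words42.card = 8 ∧ (words42.filter fun w => w 1 = true).card = 3 := by
  decide

/-- The row word of a tableau with six boxes. -/
def Tableau.word {r : ℕ} {μ : YoungDiagram} (t : Tableau r 6 μ) (j : Fin 6) : Bool := t.inSecond j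

theorem Tableau.word_injective {r : ℕ} {μ : YoungDiagram} :
    Function.Injective (word : Tableau r 6 μ → Fin 6 → Bool) := by
  intro s t h
  exact ext_inSecond fun j hj => congrFun h ⟨j, hj⟩

theorem Tableau.extendWord_word {r : ℕ} {μ : YoungDiagram} (t : Tableau r 6 μ) :
    extendWord t.word = t.inSecond := by
  ext j
  rw [extendWord]
  split_ifs with h
  · rfl
  · rw [inSecond, dif_neg h]

theorem Tableau.image_word :
    Finset.univ.image (word : Tableau 5 6 diagram42 → Fin 6 → Bool) = words42 := by
  ext w
  rw [words42, Finset.mem_image, Finset.mem_filter]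
  constructor
  · rintro ⟨t, -, rfl⟩
    rw [extendWord_word]
    refine ⟨Finset.mem_univ _, fun m => ?_, t.downs_top.trans rowLen_diagram42.2⟩
    exact ⟨t.two_mul_downs_le (by omega), t.le_two_mul_downs (by omega)⟩
  · rintro ⟨-, hm, htop⟩
    obtain ⟨t, ht⟩ := exists_of_word isTwoRow_diagram42 card_diagram42 (extendWord w)
      (fun m hm' => hm ⟨m, by omega⟩) (htop.trans rowLen_diagram42.2.symm)
    refine ⟨t, Finset.mem_univ _, funext fun j => ?_⟩
    rw [word, ht j j.isLt, extendWord, dif_pos j.isLt]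

theorem card_tableau42 : Fintype.card (Tableau 5 6 diagram42) = 8 := by
  rw [← card_words42.1, ← image_word, Finset.card_image_of_injective _ word_injective,
    Finset.card_univ]

theorem card_tableau42_second :
    (Finset.univ.filter fun t : Tableau 5 6 diagram42 => t.inSecond 1 = true).card = 3 := by
  rw [← card_words42.2, ← image_word, Finset.filter_image,
    Finset.card_image_of_injective _ word_injective]
  rfl

theorem multiplicities42 (hr : 3 ≤ 5) (i : Fin (6 - 1)) :
    Module.finrank ℂ (Module.End.eigenspace
      (sectorRep 5 6 hr diagram42 (BraidGroup.σ i)) (-1)) = 3 ∧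
    Module.finrank ℂ (Module.End.eigenspace
      (sectorRep 5 6 hr diagram42 (BraidGroup.σ i)) (q 5)) = 5 := by
  obtain ⟨h1, h2⟩ := finrank_eigenspaces (μ := diagram42) hr i
  rw [trace_projector_eq hr i ⟨0, by omega⟩, trace_projector_zero hr _ rfl,
    card_tableau42_second, Nat.cast_inj] at h1
  rw [card_tableau42] at h2
  exact ⟨h1, by omega⟩

end counting

end JonesSector

open JonesSector in
theorem theorem3p1 :
    -- (i) irreducibility
    (∀ (r n : ℕ) (hr : 3 ≤ r) (μ : YoungDiagram), IsTwoRow r μ → μ.card = n →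
      (sectorRep r n hr μ).IsIrreducible) ∧
    -- (ii) infinite modulo centre: in the quotient of the unitary group by its centre,
    -- and modulo the centre of the group itself
    (∀ (r n : ℕ) (hr : 3 ≤ r) (hn : 3 ≤ n) (μ : YoungDiagram), IsTwoRow r μ → μ.card = n →
      0 < μ.rowLen 1 → r ≠ 3 → r ≠ 4 → r ≠ 6 → r ≠ 10 →
      Infinite ((firstTwo r n hr hn μ).map (QuotientGroup.mk'
        (Subgroup.center (Matrix.unitaryGroup (Tableau r n μ) ℂ)))) ∧
      Infinite (firstTwo r n hr hn μ ⧸ Subgroup.center (firstTwo r n hr hn μ))) ∧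
    -- (iii) the eigenvalues
    (∀ (r n : ℕ) (hr : 3 ≤ r) (μ : YoungDiagram), IsTwoRow r μ → μ.card = n →
      (-1 : ℂ) ≠ q r ∧
      ∀ i : Fin (n - 1),
        (∀ z : ℂ, Module.End.HasEigenvalue (sectorRep r n hr μ (BraidGroup.σ i)) z →
          z = -1 ∨ z = q r) ∧
        (4 ≤ r → 3 ≤ n → 0 < μ.rowLen 1 →
          ∀ z : ℂ, Module.End.HasEigenvalue (sectorRep r n hr μ (BraidGroup.σ i)) z ↔
            z = -1 ∨ z = q r)) ∧
    -- (iv) the multiplicities for `r = 5`, `λ = [4, 2]`, `n = 6`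
    (∀ i : Fin (6 - 1),
      Module.finrank ℂ (Module.End.eigenspace
        (sectorRep 5 6 (by omega) diagram42 (BraidGroup.σ i)) (-1)) = 3 ∧
      Module.finrank ℂ (Module.End.eigenspace
        (sectorRep 5 6 (by omega) diagram42 (BraidGroup.σ i)) (q 5)) = 5) := by
  refine ⟨fun r n hr μ hμ hc => sectorRep_isIrreducible hr hμ hc,
    fun r n hr hn μ hμ hc h1 h3 h4 h6 h10 => infinite_mod_center hr hn hμ hc h1 h3 h4 h6 h10,
    fun r n hr μ hμ hc => ⟨fun h => ?_, fun i => ⟨fun z => eigenvalue_eq hr i,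
      fun hr4 hn h1 z => hasEigenvalue_iff hr4 hn hμ hc h1 i z⟩⟩, multiplicities42 _⟩
  exact one_add_q_ne_zero hr (by rw [← h]; norm_num)
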